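/- Let $n\ge 3$ and $2<r<n$ be integers. Let $J_1,\dots,J_n\subset\mathbb R$ be nonempty open intervals, let $f_i:J_i\to\mathbb R$ be smooth functions, and let $M^n\subset\mathbb R^{n+1}$ be the translation hypersurface given by them, that is, the graph of $(x_1,\dots,x_n)\mapsto f_1(x_1)+\cdots+f_n(x_n)$ over $J_1\times\cdots\times J_n$. Let $S_r$ denote the $r$-th elementary symmetric function of the principal curvatures of $M$ (the eigenvalues of its shape operator with respect to a unit normal field). Then $S_r\equiv 0$ on $M$ if and only if $M$ is congruent (by an isometry of $\mathbb R^{n+1}$) to the graph, over a product $K_1\times\cdots\times K_n$ of nonempty open intervals, of a function of one of the following two kinds. 1. (Vertical cylinder) $$F(x_1,\dots,x_n)=\sum_{i=1}^{n-r+1}a_ix_i+\sum_{j=n-r+2}^{n}g_j(x_j)+b,$$ where $a_i,b\in\mathbb R$ and $g_j:K_j\to\mathbb R$ are arbitrary smooth functions. 2. (Generalized periodic Enneper hypersurface) $$F(x_1,\dots,x_n)=\sum_{i=1}^{n-r-1}a_ix_i+\sum_{k=n-r}^{n-1}\frac1{a_k}\ln\left|\frac{\cos\left(-\dfrac{a_{n-r}\cdots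 a_{n-1}}{\sigma_{r-1}(a_{n-r},\dots,a_{n-1})}\sqrt\beta\,x_n+b_n\right)}{\cos\left(a_k\sqrt\beta\,x_k+b_k\right)}\right|+c,$$ where $a_1,\dots,a_{n-1},b_{n-r},\dots,b_n,c$ are real constants, $\sigma_{r-1}$ is the elementary symmetric polynomial of degree $r-1$, the numbers $a_{n-r},\dots,a_{n-1}$ and $\sigma_{r-1}(a_{n-r},\dots,a_{n-1})$ are nonzero, $\beta=1+\sum_{i=1}^{n-r-1}a_i^2$, and where $K_k\subset I_k$ for $n-r\le k\le n$; here $I_k$ is, for $n-r\le k\le n-1$, the open interval defined by $|a_k\sqrt\beta\,x_k+b_k|<\pi/2$, and $I_n$ is the open interval defined by $\left|-\frac{a_{n-r}\cdots a_{n-1}}{\sigma_{r-1}(a_{n-r},\dots,a_{n-1})}\sqrt\beta\,x_n+b_n\right|<\pi/2$. -/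

import Mathlib

open scoped ContDiff

noncomputable section

namespace TranslationHypersurface

/-- Nonempty open intervals of the real line (bounded or not). -/
def IsOpenInterval (J : Set ℝ) : Prop := IsOpen J ∧ J.OrdConnected ∧ J.Nonempty

/-- The `i`-th partial derivative of a map on `ℝⁿ`. -/
def partialDeriv {n : ℕ} {E : Type*} [NormedAddCommGroup E] [NormedSpace ℝ E]
    (i : Fin n) (X : (Fin n → ℝ) → E) (x : Fin n → ℝ) : E :=
  fderiv ℝ X x (Pi.single i 1)

/-- First fundamental form of a parametrized hypersurface, in coordinates. -/
def firstForm {n : ℕ} (X : (Fin n → ℝ) → EuclideanSpace ℝ (Fin (n + 1))) (x : Fin n → ℝ) :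
    Matrix (Fin n) (Fin n) ℝ :=
  Matrix.of fun i j => inner ℝ (partialDeriv i X x) (partialDeriv j X x)

/-- Second fundamental form of a parametrized hypersurface with unit normal field `N`,
in coordinates. -/
def secondForm {n : ℕ} (X N : (Fin n → ℝ) → EuclideanSpace ℝ (Fin (n + 1))) (x : Fin n → ℝ) :
    Matrix (Fin n) (Fin n) ℝ :=
  Matrix.of fun i j => inner ℝ (N x) (partialDeriv i (partialDeriv j X) x)

/-- Matrix of the shape operator in the coordinate basis of the tangent space. -/
def shapeMatrix {n : ℕ} (X N : (Fin n → ℝ) → EuclideanSpace ℝ (Fin (n + 1))) (x : Fin n → ℝ) :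
    Matrix (Fin n) (Fin n) ℝ :=
  (firstForm X x)⁻¹ * secondForm X N x

/-- The `r`-th curvature `S_r` (for `r ≤ n`): the `r`-th elementary symmetric function of the
eigenvalues of the shape operator `A`, read off from
`det (t I - A) = ∑ k ≤ n, (-1) ^ k * S_k * t ^ (n - k)`. -/
def curvature {n : ℕ} (r : ℕ) (X N : (Fin n → ℝ) → EuclideanSpace ℝ (Fin (n + 1)))
    (x : Fin n → ℝ) : ℝ :=
  (-1) ^ r * (shapeMatrix X N x).charpoly.coeff (n - r)

/-- The parametrization `x ↦ (x, F x)` of the graph of `F`. -/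
def graphParam {n : ℕ} (F : (Fin n → ℝ) → ℝ) (x : Fin n → ℝ) : EuclideanSpace ℝ (Fin (n + 1)) :=
  WithLp.toLp 2 (Fin.snoc (α := fun _ => ℝ) x (F x))

/-- The upward unit normal `(-∇F, 1) / √(1 + |∇F|²)` of the graph of `F`. -/
def graphNormal {n : ℕ} (F : (Fin n → ℝ) → ℝ) (x : Fin n → ℝ) : EuclideanSpace ℝ (Fin (n + 1)) :=
  (√(1 + ∑ i, partialDeriv i F x ^ 2))⁻¹ •
    WithLp.toLp 2 (Fin.snoc (α := fun _ => ℝ) (fun i => -partialDeriv i F x) 1)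

/-- The `r`-th curvature of the graph of `F` at the point over `x`. -/
def graphCurvature {n : ℕ} (r : ℕ) (F : (Fin n → ℝ) → ℝ) (x : Fin n → ℝ) : ℝ :=
  curvature r (graphParam F) (graphNormal F) x

/-- The graph of `F` over `Ω`, as a subset of `ℝⁿ⁺¹`. -/
def graphOver {n : ℕ} (F : (Fin n → ℝ) → ℝ) (Ω : Set (Fin n → ℝ)) :
    Set (EuclideanSpace ℝ (Fin (n + 1))) :=
  graphParam F '' Ω

/-- Two subsets of `ℝᵐ` are congruent if a Euclidean isometry carries one onto the other. -/
def AreCongruent {m : ℕ} (M M' : Set (EuclideanSpace ℝ (Fin m))) : Prop :=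
  ∃ φ : EuclideanSpace ℝ (Fin m) ≃ᵢ EuclideanSpace ℝ (Fin m), φ '' M = M'

/-- `F (x₁, …, xₙ) = f₁ x₁ + ⋯ + fₙ xₙ`. -/
def translationFun {n : ℕ} (f : Fin n → ℝ → ℝ) (x : Fin n → ℝ) : ℝ := ∑ i, f i (x i)

/-- `a₁ x₁ + ⋯ + a_{n-r+1} x_{n-r+1} + f_{n-r+2} x_{n-r+2} + ⋯ + fₙ xₙ + b`.
Here and below the variable `x i` for `i : Fin n` is the one with number `i + 1`. -/
def cylinderFun {n : ℕ} (r : ℕ) (a : Fin n → ℝ) (f : Fin n → ℝ → ℝ) (b : ℝ) (x : Fin n → ℝ) : ℝ :=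
  ∑ i with i.val + r ≤ n, a i * x i + ∑ j with n < j.val + r, f j (x j) + b

/-- Graphs of `cylinderFun` over products of open intervals, the `f j` being smooth. -/
def IsCylinderGraph {n : ℕ} (r : ℕ) (M : Set (EuclideanSpace ℝ (Fin (n + 1)))) : Prop :=
  ∃ (K : Fin n → Set ℝ) (a : Fin n → ℝ) (f : Fin n → ℝ → ℝ) (b : ℝ),
    (∀ i, IsOpenInterval (K i)) ∧
    (∀ j : Fin n, n < j.val + r → ContDiffOn ℝ ∞ (f j) (K j)) ∧
    M = graphOver (cylinderFun r a f b) (Set.univ.pi K)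

/-- The (positions of the) variables with numbers `1, …, n - r - 1`. -/
def affineIdx (n r : ℕ) : Finset (Fin n) := {i | i.val + r + 1 < n}

/-- The (positions of the) variables with numbers `n - r, …, n - 1`. -/
def cosIdx (n r : ℕ) : Finset (Fin n) := {i | n ≤ i.val + 1 + r ∧ i.val + 1 < n}

/-- The position of the variable with number `n`. -/
def lastIdx {n r : ℕ} (h : r < n) : Fin n := ⟨n - 1, by omega⟩

/-- The `k`-th elementary symmetric polynomial of the numbers `a i`, `i ∈ s`. -/
def elemSymm {n : ℕ} (k : ℕ) (s : Finset (Fin n)) (a : Fin n → ℝ) : ℝ :=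
  ∑ t ∈ s.powersetCard k, ∏ i ∈ t, a i

/-- `β = 1 + a₁² + ⋯ + a_{n-r-1}²`. -/
def enneperBeta {n : ℕ} (r : ℕ) (a : Fin n → ℝ) : ℝ := 1 + ∑ i ∈ affineIdx n r, a i ^ 2

/-- `- a_{n-r} ⋯ a_{n-1} / σ_{r-1}(a_{n-r}, …, a_{n-1})`. -/
def enneperSlope {n : ℕ} (r : ℕ) (a : Fin n → ℝ) : ℝ :=
  -((∏ k ∈ cosIdx n r, a k) / elemSymm (r - 1) (cosIdx n r) a)

/-- The function whose graph is a generalized periodic Enneper hypersurface. -/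
def enneperFun {n r : ℕ} (h : r < n) (a b : Fin n → ℝ) (c : ℝ) (x : Fin n → ℝ) : ℝ :=
  ∑ i ∈ affineIdx n r, a i * x i +
    ∑ k ∈ cosIdx n r, 1 / a k * Real.log
      |Real.cos (enneperSlope r a * √(enneperBeta r a) * x (lastIdx h) + b (lastIdx h)) /
        Real.cos (a k * √(enneperBeta r a) * x k + b k)| + c

/-- Graphs of `enneperFun` over products of open intervals on which the arguments of the cosines
lie in `(-π/2, π/2)`. -/
def IsEnneperGraph {n r : ℕ} (h : r < n) (M : Set (EuclideanSpace ℝ (Fin (n + 1)))) : Prop :=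
  ∃ (K : Fin n → Set ℝ) (a b : Fin n → ℝ) (c : ℝ),
    (∀ i, IsOpenInterval (K i)) ∧
    (∀ k ∈ cosIdx n r, a k ≠ 0) ∧
    elemSymm (r - 1) (cosIdx n r) a ≠ 0 ∧
    (∀ k ∈ cosIdx n r, ∀ t ∈ K k, |a k * √(enneperBeta r a) * t + b k| < Real.pi / 2) ∧
    (∀ t ∈ K (lastIdx h),
      |enneperSlope r a * √(enneperBeta r a) * t + b (lastIdx h)| < Real.pi / 2) ∧
    M = graphOver (enneperFun h a b c) (Set.univ.pi K)

end TranslationHypersurface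

end

/-! In graph coordinates the first fundamental form is the identity plus a rank-one matrix and the
second is a positive multiple of diag(f_i''). The matrix determinant lemma therefore gives S_r, up
to a positive factor, as the mixed sum e_r(h) + ∑ w_m e_r(h without h_m), with h_i = f_i'' and w_i =
f_i'². The equation S_r = 0 is then an algebraic condition on the curves t ↦ (f_i'', f_i'²), whose
parameters vary independently.

Let A be the set of indices with f_i'' not identically zero. The affine variables only replace the
coefficient 1 of e_r(h) by β = 1 + (sum of their squared slopes). The core is the bound |A| ≤ r + 1
(`card_le_of_mixedSum_eq_zero`). The mixed sum is affine in each pair (h_i, w_i), so if |A| were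
larger, every curve would lie on a line h_i = γ_i + δ_i w_i, or else a smaller index set would
already give a contradiction. On these lines the mixed sum is a polynomial affine in each w_i, so it
vanishes identically, and special values of w rule this out (`false_of_mixedSum_affine`).

If |A| < r, the hypersurface is a cylinder after a permutation of variables. If |A| = r, the mixed
sum is β ∏ h_i, which is not identically zero. If |A| = r + 1, dividing by ∏ h_i separates the
variables: c_i f_i'' = β + f_i'² with nonzero constants of sum 0 (`exists_separation_constants`).
Integration gives log-cosines with rates 1/c_i, and ∑ c_i = 0 is exactly the formula for the
coefficient of x_n.

Conversely, both models are translation graphs satisfying the mixed-sum equation, and the vanishing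
of S_r passes through isometries because shape matrices are conjugate up to sign
(`graphCurvature_eq_zero_of_isometry`). -/

noncomputable section

namespace TranslationHypersurface

open Finset Function

/-! ### Elementary symmetric functions over finite index sets -/

section ElementarySymmetric

variable {n : ℕ}

theorem elemSymm_zero (s : Finset (Fin n)) (a : Fin n → ℝ) : elemSymm 0 s a = 1 := by
  simp [elemSymm]

theorem elemSymm_congr {k : ℕ} {s : Finset (Fin n)} {a b : Fin n → ℝ} (h : ∀ i ∈ s, a i = b i) :
    elemSymm k s a = elemSymm k s b := by
  refine Finset.sum_congr rfl fun t ht => Finset.prod_congr rfl fun i hi => ?_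
  exact h i ((Finset.mem_powersetCard.1 ht).1 hi)

theorem elemSymm_insert {k : ℕ} {s : Finset (Fin n)} {i : Fin n} (hi : i ∉ s) (a : Fin n → ℝ) :
    elemSymm (k + 1) (insert i s) a = elemSymm (k + 1) s a + a i * elemSymm k s a := by
  unfold elemSymm
  have hmem : ∀ t ∈ powersetCard k s, i ∉ t := fun t ht h =>
    hi ((Finset.mem_powersetCard.1 ht).1 h)
  rw [Finset.powersetCard_succ_insert hi, Finset.sum_union, Finset.sum_image, Finset.mul_sum]
  · congr 1
    exact Finset.sum_congr rfl fun t ht => Finset.prod_insert (hmem t ht)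
  · intro t ht u hu h
    rw [← Finset.erase_insert (hmem t ht), ← Finset.erase_insert (hmem u hu), h]
  · rw [Finset.disjoint_left]
    intro t ht ht'
    obtain ⟨u, -, rfl⟩ := Finset.mem_image.1 ht'
    exact hi ((Finset.mem_powersetCard.1 ht).1 (Finset.mem_insert_self _ _))

theorem elemSymm_erase {k : ℕ} {s : Finset (Fin n)} {i : Fin n} (hi : i ∈ s) (a : Fin n → ℝ) :
    elemSymm (k + 1) s a =
      elemSymm (k + 1) (s.erase i) a + a i * elemSymm k (s.erase i) a := by
  rw [← elemSymm_insert (Finset.notMem_erase i s), Finset.insert_erase hi]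

theorem elemSymm_of_card_lt {k : ℕ} {s : Finset (Fin n)} (h : s.card < k) (a : Fin n → ℝ) :
    elemSymm k s a = 0 := by
  simp [elemSymm, Finset.powersetCard_eq_empty.2 h]

theorem elemSymm_card (s : Finset (Fin n)) (a : Fin n → ℝ) :
    elemSymm s.card s a = ∏ i ∈ s, a i := by
  simp [elemSymm, Finset.powersetCard_self]

/-- Double counting: a k-subset of `s` survives the removal of exactly the |s| - k indices outside
it. -/
theorem sum_elemSymm_erase (k : ℕ) (s : Finset (Fin n)) (a : Fin n → ℝ) :
    ∑ i ∈ s, elemSymm k (s.erase i) a = ((s.card : ℝ) - k) * elemSymm k s a := by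
  induction s using Finset.induction_on generalizing k with
  | empty =>
    cases k with
    | zero => simp
    | succ k => simp [elemSymm_of_card_lt (s := (∅ : Finset (Fin n))) (Nat.succ_pos k)]
  | insert j s hj ih =>
    rw [Finset.sum_insert hj, Finset.erase_insert hj, Finset.card_insert_of_notMem hj]
    cases k with
    | zero => simp [elemSymm_zero]; ring
    | succ k =>
      have : ∑ i ∈ s, elemSymm (k + 1) ((insert j s).erase i) a =
          ∑ i ∈ s, (elemSymm (k + 1) (s.erase i) a + a j * elemSymm k (s.erase i) a) := by
        refine Finset.sum_congr rfl fun i hi => ?_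
        have hij : j ≠ i := fun h => hj (h ▸ hi)
        rw [Finset.erase_insert_of_ne hij, elemSymm_insert]
        exact fun h => hj (Finset.mem_of_mem_erase h)
      rw [this, Finset.sum_add_distrib, ← Finset.mul_sum, ih, ih, elemSymm_insert hj]
      push_cast
      ring

theorem elemSymm_of_subset {k : ℕ} {s t : Finset (Fin n)} {a : Fin n → ℝ} (hst : s ⊆ t)
    (h : ∀ i ∈ t, i ∉ s → a i = 0) : elemSymm k t a = elemSymm k s a := by
  symm
  refine Finset.sum_subset (Finset.powersetCard_mono hst) fun u hu hu' => ?_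
  rw [Finset.mem_powersetCard] at hu hu'
  have : ∃ i ∈ u, i ∉ s := by
    by_contra! hc
    exact hu' ⟨hc, hu.2⟩
  obtain ⟨i, hi, his⟩ := this
  exact Finset.prod_eq_zero hi (h i (hu.1 hi) his)

theorem elemSymm_card_succ {k : ℕ} {s : Finset (Fin n)} (hs : s.card = k + 1) {a : Fin n → ℝ}
    (ha : ∀ i ∈ s, a i ≠ 0) : elemSymm k s a = (∏ i ∈ s, a i) * ∑ i ∈ s, (a i)⁻¹ := by
  have h := sum_elemSymm_erase k s a
  rw [hs] at h
  push_cast at h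
  rw [add_sub_cancel_left, one_mul] at h
  rw [← h, Finset.mul_sum]
  refine Finset.sum_congr rfl fun i hi => ?_
  have hc : (s.erase i).card = k := by rw [Finset.card_erase_of_mem hi, hs]; rfl
  rw [← hc, elemSymm_card, ← Finset.mul_prod_erase s a hi]
  field_simp [ha i hi]

theorem elemSymm_smul (k : ℕ) (s : Finset (Fin n)) (c : ℝ) (a : Fin n → ℝ) :
    elemSymm k s (fun i => c * a i) = c ^ k * elemSymm k s a := by
  unfold elemSymm
  rw [Finset.mul_sum]
  refine Finset.sum_congr rfl fun t ht => ?_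
  rw [Finset.prod_mul_distrib, Finset.prod_const, (Finset.mem_powersetCard.1 ht).2]

theorem elemSymm_indicator_card (I s : Finset (Fin n)) (k : ℕ) (h : I ⊆ s) :
    elemSymm k s (fun i => if i ∈ I then 1 else 0) = (I.card.choose k : ℝ) := by
  rw [elemSymm_of_subset h fun i _ hi => if_neg hi,
    elemSymm_congr (b := fun _ => 1) fun i hi => if_pos hi]
  simp [elemSymm]

/-- Nonzero numbers cannot have all their erased elementary symmetric functions vanish. -/
theorem false_of_elemSymm_erase_eq_zero {k : ℕ} {s : Finset (Fin n)} {a : Fin n → ℝ}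
    (hk : k < s.card) (ha : ∀ i ∈ s, a i ≠ 0) (h : ∀ i ∈ s, elemSymm k (s.erase i) a = 0) :
    False := by
  induction k with
  | zero =>
    obtain ⟨i, hi⟩ := Finset.card_pos.1 hk
    simpa [elemSymm_zero] using h i hi
  | succ k ih =>
    -- Descent in the degree: double counting kills e_{k+1} on all of `s`, and expanding it along
    -- `i` then kills e_k without `i`. The descent ends at e_0 = 1.
    refine ih (by omega) fun i hi => ?_
    have h0 : elemSymm (k + 1) s a = 0 := by
      have := sum_elemSymm_erase (k + 1) s a
      rw [Finset.sum_eq_zero h] at this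
      rcases mul_eq_zero.1 this.symm with h' | h'
      · have : (s.card : ℝ) = ((k + 1 : ℕ) : ℝ) := by linarith
        have := Nat.cast_injective this
        omega
      · exact h'
    have := elemSymm_erase (k := k) hi a
    rw [h0, h i hi, zero_add] at this
    exact (mul_eq_zero.1 this.symm).resolve_left (ha i hi)

/-- The same with some further entries that may be chosen freely. -/
theorem false_of_elemSymm_erase_eq_zero_of_free {k : ℕ} {C D : Finset (Fin n)} {c : Fin n → ℝ}
    (hCD : Disjoint C D) (hk : k < (C ∪ D).card) (hC : C.Nonempty) (hc : ∀ i ∈ C, c i ≠ 0)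
    (h : ∀ a : Fin n → ℝ, (∀ i ∈ C, a i = c i) →
      ∀ i ∈ C, elemSymm k ((C ∪ D).erase i) a = 0) : False := by
  induction D using Finset.induction_on generalizing k with
  | empty =>
    rw [Finset.union_empty] at *
    exact false_of_elemSymm_erase_eq_zero hk hc (h c fun _ _ => rfl)
  | insert j D hj ih =>
    have hjC : j ∉ C := fun hjC => Finset.disjoint_left.1 hCD hjC (Finset.mem_insert_self _ _)
    have hjU : j ∉ C ∪ D := by simp [hjC, hj]
    obtain ⟨i₀, hi₀⟩ := hC
    cases k with
    | zero => simpa [elemSymm_zero] using h c (fun _ _ => rfl) i₀ hi₀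
    | succ k =>
      refine ih (k := k) (Finset.disjoint_of_subset_right (Finset.subset_insert _ _) hCD) ?_ ?_
      · rw [Finset.union_insert, Finset.card_insert_of_notMem hjU] at hk
        omega
      · intro a ha i hi
        have hij : j ≠ i := fun h => hjC (h ▸ hi)
        -- The free entry `j` enters affinely, so its coefficient vanishes; this removes `j` and
        -- lowers the degree by one.
        have key : ∀ t : ℝ, elemSymm (k + 1) ((C ∪ D).erase i) a +
            t * elemSymm k ((C ∪ D).erase i) a = 0 := by
          intro t
          have h1 := h (update a j t) (fun l hl => by
            rw [update_of_ne (ne_of_mem_of_not_mem hl hjC), ha l hl]) i hi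
          have hjE : j ∉ (C ∪ D).erase i := fun h => hjU (Finset.mem_of_mem_erase h)
          have hcg : ∀ m, elemSymm m ((C ∪ D).erase i) (update a j t) =
              elemSymm m ((C ∪ D).erase i) a := fun m =>
            elemSymm_congr fun l hl => update_of_ne (ne_of_mem_of_not_mem hl hjE) _ _
          rwa [Finset.union_insert, Finset.erase_insert_of_ne hij, elemSymm_insert hjE, hcg, hcg,
            update_self] at h1
        linarith [key 0, key 1]

end ElementarySymmetric

/-! ### The mixed sum -/

section MixedSum

variable {n : ℕ}

/-- `β e_k(h) + ∑ m, w m * e_k(h without h m)`, the sums running over the index set `A`. For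
`β = 1`, with `h` the second derivatives and `w` the squared slopes, this is `S_k` of a translation
hypersurface up to a positive factor. -/
def mixedSum (k : ℕ) (A : Finset (Fin n)) (β : ℝ) (h w : Fin n → ℝ) : ℝ :=
  β * elemSymm k A h + ∑ m ∈ A, w m * elemSymm k (A.erase m) h

theorem mixedSum_congr {k : ℕ} {A : Finset (Fin n)} {β : ℝ} {h w h' w' : Fin n → ℝ}
    (hh : ∀ i ∈ A, h i = h' i) (hw : ∀ i ∈ A, w i = w' i) :
    mixedSum k A β h w = mixedSum k A β h' w' := by
  unfold mixedSum
  rw [elemSymm_congr hh]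
  congr 1
  refine Finset.sum_congr rfl fun i hi => ?_
  rw [hw i hi, elemSymm_congr fun l hl => hh l (Finset.mem_of_mem_erase hl)]

/-- The engine of the separation argument: the mixed sum is affine in the pair (h_i, w_i), with
coefficients free of the index i. -/
theorem mixedSum_erase {k : ℕ} {A : Finset (Fin n)} {i : Fin n} (hi : i ∈ A) (β : ℝ)
    (h w : Fin n → ℝ) :
    mixedSum (k + 1) A β h w =
      h i * mixedSum k (A.erase i) β h w + mixedSum (k + 1) (A.erase i) β h w +
        w i * elemSymm (k + 1) (A.erase i) h := by
  unfold mixedSum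
  rw [← Finset.add_sum_erase A _ hi, elemSymm_erase hi]
  have : ∀ m ∈ A.erase i, w m * elemSymm (k + 1) (A.erase m) h =
      w m * elemSymm (k + 1) ((A.erase i).erase m) h +
        h i * (w m * elemSymm k ((A.erase i).erase m) h) := by
    intro m hm
    rw [elemSymm_erase (s := A.erase m) (i := i), Finset.erase_right_comm]
    · ring
    · exact Finset.mem_erase.2 ⟨(Finset.ne_of_mem_erase hm).symm, hi⟩
  rw [Finset.sum_congr rfl this, Finset.sum_add_distrib, ← Finset.mul_sum]
  ring

/-- For an index with h = 0, removing it does not change e_k, so its weight merely joins the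
coefficient of e_k. This is how affine variables produce the constant β of the Enneper family. -/
theorem mixedSum_of_subset {k : ℕ} {A B : Finset (Fin n)} {β : ℝ} {h w : Fin n → ℝ} (hAB : A ⊆ B)
    (hh : ∀ i ∈ B, i ∉ A → h i = 0) :
    mixedSum k B β h w = mixedSum k A (β + ∑ m ∈ B \ A, w m) h w := by
  unfold mixedSum
  rw [elemSymm_of_subset hAB hh, ← Finset.sum_sdiff hAB, add_mul, Finset.sum_mul, add_assoc]
  congr 2
  · refine Finset.sum_congr rfl fun m hm => ?_
    rw [Finset.mem_sdiff] at hm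
    rw [elemSymm_of_subset (s := A)]
    · exact fun i hi => Finset.mem_erase.2 ⟨fun h => hm.2 (h ▸ hi), hAB hi⟩
    · exact fun i hi hiA => hh i (Finset.mem_of_mem_erase hi) hiA
  · refine Finset.sum_congr rfl fun m hm => ?_
    rw [elemSymm_of_subset (Finset.erase_subset_erase m hAB)]
    intro i hi hiA
    rw [Finset.mem_erase] at hi
    exact hh i hi.2 fun hA => hiA (Finset.mem_erase.2 ⟨hi.1, hA⟩)

theorem mixedSum_of_card_lt {k : ℕ} {A : Finset (Fin n)} (hA : A.card < k) (β : ℝ)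
    (h w : Fin n → ℝ) : mixedSum k A β h w = 0 := by
  unfold mixedSum
  rw [elemSymm_of_card_lt hA, Finset.sum_eq_zero, mul_zero, add_zero]
  intro m _
  rw [elemSymm_of_card_lt ((Finset.card_le_card (Finset.erase_subset m A)).trans_lt hA), mul_zero]

theorem mixedSum_card (A : Finset (Fin n)) (β : ℝ) (h w : Fin n → ℝ) :
    mixedSum A.card A β h w = β * ∏ i ∈ A, h i := by
  unfold mixedSum
  rw [elemSymm_card, Finset.sum_eq_zero, add_zero]
  intro m hm
  rw [elemSymm_of_card_lt (Finset.card_erase_lt_of_mem hm), mul_zero]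

theorem mixedSum_card_succ {k : ℕ} {A : Finset (Fin n)} (hA : A.card = k + 1) (β : ℝ)
    (h w : Fin n → ℝ) :
    mixedSum k A β h w = ∑ m ∈ A, (β + w m) * ∏ i ∈ A.erase m, h i := by
  have h1 := sum_elemSymm_erase k A h
  rw [hA] at h1
  push_cast at h1
  rw [add_sub_cancel_left, one_mul] at h1
  unfold mixedSum
  rw [← h1, Finset.mul_sum, ← Finset.sum_add_distrib]
  refine Finset.sum_congr rfl fun i hi => ?_
  have hc : (A.erase i).card = k := by rw [Finset.card_erase_of_mem hi, hA]; rfl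
  rw [← hc, elemSymm_card]
  ring

end MixedSum

/-! ### Separation of variables and the bound on the number of non-affine variables -/

section Separation

variable {n : ℕ}

/-- A function that is affine in each of the variables from `A` and vanishes on a product of sets
with at least two elements each vanishes identically. -/
theorem eq_zero_of_affine_of_nontrivial {A : Finset (Fin n)} {G : (Fin n → ℝ) → ℝ}
    (hG : ∀ w, ∀ i ∈ A, ∃ a b, ∀ t, G (update w i t) = a + b * t)
    {S : Fin n → Set ℝ} (hS : ∀ i ∈ A, ∃ s ∈ S i, ∃ t ∈ S i, s ≠ t)
    (h0 : ∀ w, (∀ i ∈ A, w i ∈ S i) → G w = 0) (w : Fin n → ℝ) : G w = 0 := by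
  -- `B` is the set of coordinates already released from the constraint `w i ∈ S i`; an affine
  -- function with two zeros releases one more.
  have key : ∀ B : Finset (Fin n), B ⊆ A → ∀ w, (∀ i ∈ A, i ∉ B → w i ∈ S i) → G w = 0 := by
    intro B
    induction B using Finset.induction_on with
    | empty => exact fun _ w hw => h0 w fun i hi => hw i hi (Finset.notMem_empty i)
    | insert j B hj ih =>
      intro hB w hw
      have hjA : j ∈ A := hB (Finset.mem_insert_self _ _)
      have hz : ∀ t ∈ S j, G (update w j t) = 0 := by
        refine fun t ht => ih (fun i hi => hB (Finset.mem_insert_of_mem hi)) _ fun i hi hiB => ?_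
        by_cases hij : i = j
        · subst hij
          rwa [update_self]
        · rw [update_of_ne hij]
          exact hw i hi (by simp [hij, hiB])
      obtain ⟨a, b, hab⟩ := hG w j hjA
      obtain ⟨s, hs, t, ht, hst⟩ := hS j hjA
      have h1 := hz s hs
      have h2 := hz t ht
      rw [hab] at h1 h2
      have hb : b = 0 := by
        have : b * (s - t) = 0 := by linarith
        exact (mul_eq_zero.1 this).resolve_right (sub_ne_zero.2 hst)
      have := hab (w j)
      rw [update_eq_self] at this
      subst hb
      linarith
  exact key A subset_rfl w fun i hi hi' => absurd hi hi'

variable {A : Finset (Fin n)} {β : ℝ} {V : Fin n → Set (ℝ × ℝ)} {k : ℕ}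

/-- With one index more than the degree, the vanishing of the mixed sum separates the variables. -/
theorem exists_separation_constants (hA : A.card = k + 2)
    (h1 : ∀ i ∈ A, ∃ v ∈ V i, v.1 ≠ 0) (hβ : ∀ i ∈ A, ∀ v ∈ V i, 0 < β + v.2)
    (hQ : ∀ h w : Fin n → ℝ, (∀ i ∈ A, (h i, w i) ∈ V i) → mixedSum (k + 1) A β h w = 0) :
    ∃ c : Fin n → ℝ, (∀ i ∈ A, c i ≠ 0) ∧ (∀ i ∈ A, ∀ v ∈ V i, c i * v.1 = β + v.2) ∧
      ∑ i ∈ A, c i = 0 := by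
  have h1' : ∀ i, ∃ v : ℝ × ℝ, i ∈ A → v ∈ V i ∧ v.1 ≠ 0 := fun i => by
    by_cases hi : i ∈ A
    · obtain ⟨v, hv⟩ := h1 i hi
      exact ⟨v, fun _ => hv⟩
    · exact ⟨0, fun h => absurd h hi⟩
  choose u hu using h1'
  set h₀ : Fin n → ℝ := fun i => (u i).1
  set w₀ : Fin n → ℝ := fun i => (u i).2
  have hne : ∀ i ∈ A, h₀ i ≠ 0 := fun i hi => (hu i hi).2
  have hprod : ∀ i, ∏ l ∈ A.erase i, h₀ l ≠ 0 := fun i =>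
    Finset.prod_ne_zero_iff.2 fun l hl => hne l (Finset.mem_of_mem_erase hl)
  -- Freeze all variables but the i-th at the base point. In top degree the expansion reads v₁ ·
  -- (mixed sum) + (β + v₂) ∏ h₀ = 0, which is solved for (β + v₂) / v₁.
  set c : Fin n → ℝ := fun i => -mixedSum k (A.erase i) β h₀ w₀ / ∏ l ∈ A.erase i, h₀ l
  have hc : ∀ i ∈ A, ∀ v ∈ V i, c i * v.1 = β + v.2 := by
    intro i hi v hv
    have hcard : (A.erase i).card = k + 1 := by rw [Finset.card_erase_of_mem hi, hA]; rfl
    have e := hQ (update h₀ i v.1) (update w₀ i v.2) fun l hl => by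
      by_cases hli : l = i
      · subst hli
        simpa using hv
      · rw [update_of_ne hli, update_of_ne hli]
        exact (hu l hl).1
    have hup : ∀ (f : Fin n → ℝ) (t : ℝ), ∀ l ∈ A.erase i, update f i t l = f l :=
      fun f t l hl => update_of_ne (Finset.ne_of_mem_erase hl) _ _
    rw [mixedSum_erase hi, update_self, update_self,
      mixedSum_congr (hup h₀ _) (hup w₀ _), mixedSum_congr (hup h₀ _) (hup w₀ _),
      elemSymm_congr (hup h₀ _), ← hcard, mixedSum_card, elemSymm_card] at e
    have hp := hprod i
    simp only [c]
    field_simp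
    linarith
  refine ⟨c, fun i hi h0 => ?_, hc, ?_⟩
  · have := hc i hi _ (hu i hi).1
    have := hβ i hi _ (hu i hi).1
    simp_all
  · have e := hQ h₀ w₀ fun i hi => (hu i hi).1
    rw [mixedSum_card_succ hA] at e
    have : ∀ m ∈ A, (β + w₀ m) * ∏ i ∈ A.erase m, h₀ i = (∏ i ∈ A, h₀ i) * c m := by
      intro m hm
      rw [← Finset.mul_prod_erase A h₀ hm, ← hc m hm _ (hu m hm).1]
      ring
    rw [Finset.sum_congr rfl this, ← Finset.mul_sum] at e
    exact (mul_eq_zero.1 e).resolve_left (Finset.prod_ne_zero_iff.2 hne)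

theorem exists_mem_of_forall (h1 : ∀ i ∈ A, ∃ v ∈ V i, v.1 ≠ 0) :
    ∃ h w : Fin n → ℝ, ∀ i ∈ A, (h i, w i) ∈ V i := by
  have h1' : ∀ i, ∃ v : ℝ × ℝ, i ∈ A → v ∈ V i := fun i => by
    by_cases hi : i ∈ A
    · obtain ⟨v, hv, -⟩ := h1 i hi
      exact ⟨v, fun _ => hv⟩
    · exact ⟨0, fun h => absurd h hi⟩
  choose u hu using h1'
  exact ⟨fun i => (u i).1, fun i => (u i).2, fun i hi => hu i hi⟩

theorem update_mem_of_mem {i : Fin n} {h w : Fin n → ℝ}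
    (hw : ∀ l ∈ A.erase i, (h l, w l) ∈ V l) {v : ℝ × ℝ} (hv : v ∈ V i) :
    ∀ l ∈ A, (update h i v.1 l, update w i v.2 l) ∈ V l := by
  intro l hl
  by_cases hli : l = i
  · subst hli
    simpa using hv
  · rw [update_of_ne hli, update_of_ne hli]
    exact hw l (Finset.mem_erase.2 ⟨hli, hl⟩)

/-- With one index more than the degree, the mixed sum and the elementary symmetric function cannot
vanish together. -/
theorem false_of_mixedSum_of_elemSymm (hA : A.card = k + 2)
    (h1 : ∀ i ∈ A, ∃ v ∈ V i, v.1 ≠ 0) (h2 : ∀ i ∈ A, ∃ u ∈ V i, ∃ v ∈ V i, u.2 ≠ v.2)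
    (hβ : ∀ i ∈ A, ∀ v ∈ V i, 0 < β + v.2)
    (hQ : ∀ h w : Fin n → ℝ, (∀ i ∈ A, (h i, w i) ∈ V i) → mixedSum (k + 1) A β h w = 0)
    (hE : ∀ h w : Fin n → ℝ, (∀ i ∈ A, (h i, w i) ∈ V i) → elemSymm (k + 1) A h = 0) :
    False := by
  obtain ⟨c, -, hc, -⟩ := exists_separation_constants hA h1 hβ hQ
  obtain ⟨h, w, hw⟩ := exists_mem_of_forall h1
  obtain ⟨j, hj⟩ : A.Nonempty := Finset.card_pos.1 (by omega)
  obtain ⟨u, hu, v, hv, huv⟩ := h2 j hj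
  have hcard : (A.erase j).card = k + 1 := by rw [Finset.card_erase_of_mem hj, hA]; rfl
  have hne : ∀ i ∈ A, h i ≠ 0 := fun i hi h0 => by
    have e := hc i hi _ (hw i hi)
    have e' := hβ i hi _ (hw i hi)
    simp only [h0, mul_zero] at e
    linarith
  have key : ∀ x ∈ V j, elemSymm (k + 1) (A.erase j) h + x.1 * elemSymm k (A.erase j) h = 0 := by
    intro x hx
    have e := hE _ _ (update_mem_of_mem (fun l hl => hw l (Finset.mem_of_mem_erase hl)) hx)
    have hup : ∀ l ∈ A.erase j, update h j x.1 l = h l :=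
      fun l hl => update_of_ne (Finset.ne_of_mem_erase hl) _ _
    rwa [elemSymm_erase hj, elemSymm_congr hup, elemSymm_congr hup, update_self] at e
  -- The separation relation makes h_j take two values because w_j does, so both coefficients in
  -- `key` vanish; one of them is a product of nonzero numbers.
  have e0 : elemSymm k (A.erase j) h = 0 := by
    have e : (u.1 - v.1) * elemSymm k (A.erase j) h = 0 := by linarith [key u hu, key v hv]
    refine (mul_eq_zero.1 e).resolve_left fun e' => huv ?_
    have := hc j hj u hu
    have := hc j hj v hv
    rw [sub_eq_zero.1 e'] at *
    linarith
  have e1 := key u hu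
  rw [e0, mul_zero, add_zero, ← hcard, elemSymm_card] at e1
  exact Finset.prod_ne_zero_iff.2 (fun l hl => hne l (Finset.mem_of_mem_erase hl)) e1

/-- With all slopes nonzero, w can be chosen so that h is the indicator of any I ⊆ A. Comparing |I|
= k + 1 with |I| = k + 2 shows that the reciprocals 1/δ_m sum to 0 over every (k + 2)-subset, which
is impossible inside a set of k + 3 indices. -/
theorem false_of_mixedSum_affine_of_slopes (hA : k + 3 ≤ A.card) {γ δ : Fin n → ℝ}
    (hδ : ∀ i ∈ A, δ i ≠ 0)
    (hG : ∀ w : Fin n → ℝ, mixedSum (k + 1) A β (fun i => γ i + δ i * w i) w = 0) : False := by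
  have hind : ∀ I ⊆ A, β * (I.card.choose (k + 1) : ℝ) + ∑ m ∈ A,
      ((if m ∈ I then 1 else 0) - γ m) / δ m * ((I.erase m).card.choose (k + 1) : ℝ) = 0 := by
    intro I hI
    have e := hG fun i => ((if i ∈ I then 1 else 0) - γ i) / δ i
    rw [mixedSum_congr (h' := fun i => if i ∈ I then 1 else 0) (fun i hi => by
      have := hδ i hi
      field_simp
      ring) (fun _ _ => rfl), mixedSum, elemSymm_indicator_card I A _ hI] at e
    refine Eq.trans ?_ e
    congr 1
    refine Finset.sum_congr rfl fun m _ => ?_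
    rw [← elemSymm_indicator_card (I.erase m) (A.erase m) _ (Finset.erase_subset_erase m hI)]
    congr 1
    refine elemSymm_congr fun i hi => ?_
    simp [Finset.ne_of_mem_erase hi]
  have hsmall : ∀ I ⊆ A, I.card = k + 1 → β = ∑ m ∈ A \ I, γ m / δ m := by
    intro I hI hc
    have e := hind I hI
    rw [hc, Nat.choose_self, ← Finset.sum_sdiff hI, Finset.sum_eq_zero (s := I)] at e
    · rw [Finset.sum_congr rfl (g := fun m => -(γ m / δ m))] at e
      · rw [Finset.sum_neg_distrib] at e
        push_cast at e
        linarith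
      · intro m hm
        have hm' := (Finset.mem_sdiff.1 hm).2
        rw [Finset.erase_eq_of_notMem hm', hc, Nat.choose_self, if_neg hm']
        push_cast
        ring
    · intro m hm
      rw [Nat.choose_eq_zero_of_lt (by rw [Finset.card_erase_of_mem hm]; omega)]
      simp
  have hlarge : ∀ I ⊆ A, I.card = k + 2 → ∑ m ∈ I, (δ m)⁻¹ = 0 := by
    intro I hI hc
    have e := hind I hI
    have hch : (k + 2).choose (k + 1) = k + 2 := Nat.choose_succ_self_right (k + 1)
    have hl : ∀ l ∈ I, β = ∑ m ∈ A \ I, γ m / δ m + γ l / δ l := by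
      intro l hl
      rw [hsmall (I.erase l) ((Finset.erase_subset _ _).trans hI)
        (by rw [Finset.card_erase_of_mem hl, hc]; rfl)]
      rw [show A \ I.erase l = insert l (A \ I) by
        ext x
        simp only [Finset.mem_sdiff, Finset.mem_erase, Finset.mem_insert]
        have := @hI x
        have := hI hl
        by_cases hx : x = l <;> simp_all]
      rw [Finset.sum_insert (by simp [hl])]
      ring
    -- Adding the k + 2 relations for the sets I minus one element eliminates β and γ from the
    -- relation for I.
    have hsum := Finset.sum_congr (s₁ := I) rfl hl
    rw [Finset.sum_add_distrib, Finset.sum_const, Finset.sum_const, hc, nsmul_eq_mul,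
      nsmul_eq_mul] at hsum
    rw [hc, hch, ← Finset.sum_sdiff hI,
      Finset.sum_congr rfl (g := fun m => -((k + 2 : ℕ) : ℝ) * (γ m / δ m)),
      Finset.sum_congr (s₁ := I) rfl (g := fun m => (δ m)⁻¹ - γ m / δ m),
      Finset.sum_sub_distrib, ← Finset.mul_sum] at e
    · linarith
    · intro m hm
      rw [Finset.card_erase_of_mem hm, hc, if_pos hm]
      simp
      ring
    · intro m hm
      have hm' := (Finset.mem_sdiff.1 hm).2
      rw [Finset.erase_eq_of_notMem hm', hc, hch, if_neg hm']
      ring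
  obtain ⟨I, hI, hc⟩ := Finset.exists_subset_card_eq hA
  have hall : ∀ l ∈ I, (δ l)⁻¹ = ∑ m ∈ I, (δ m)⁻¹ := by
    intro l hl
    have := hlarge (I.erase l) ((Finset.erase_subset _ _).trans hI)
      (by rw [Finset.card_erase_of_mem hl, hc]; rfl)
    rw [← Finset.add_sum_erase I _ hl, this, add_zero]
  have hS := Finset.sum_congr (s₁ := I) rfl hall
  rw [Finset.sum_const, hc, nsmul_eq_mul] at hS
  have hS0 : ∑ m ∈ I, (δ m)⁻¹ = 0 := by
    have : ((k + 2 : ℕ) : ℝ) * ∑ m ∈ I, (δ m)⁻¹ = 0 := by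
      push_cast at hS ⊢
      linarith
    exact (mul_eq_zero.1 this).resolve_left (by positivity)
  obtain ⟨l, hl⟩ : I.Nonempty := Finset.card_pos.1 (by omega)
  have := hall l hl
  rw [hS0] at this
  exact hδ l (hI hl) (inv_eq_zero.1 this)

/-- If δ_i = 0, then h_i is a nonzero constant and w_i occurs only as a weight, so its coefficient
e_{k+1}(h without h_i) vanishes. The entries with nonzero slope are arbitrary, which is the
situation of `false_of_elemSymm_erase_eq_zero_of_free`. -/
theorem false_of_mixedSum_affine (hA : k + 3 ≤ A.card) {γ δ : Fin n → ℝ}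
    (hγδ : ∀ i ∈ A, δ i = 0 → γ i ≠ 0)
    (hG : ∀ w : Fin n → ℝ, mixedSum (k + 1) A β (fun i => γ i + δ i * w i) w = 0) : False := by
  by_cases hδ : ∀ i ∈ A, δ i ≠ 0
  · exact false_of_mixedSum_affine_of_slopes hA hδ hG
  push Not at hδ
  obtain ⟨i₀, hi₀, hδ₀⟩ := hδ
  have hU := Finset.filter_union_filter_not_eq (fun i => δ i = 0) A
  refine false_of_elemSymm_erase_eq_zero_of_free (k := k + 1) (C := A.filter fun i => δ i = 0)
    (D := A.filter fun i => ¬ δ i = 0) (c := γ) (Finset.disjoint_filter_filter_not _ _ _) ?_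
    ⟨i₀, Finset.mem_filter.2 ⟨hi₀, hδ₀⟩⟩ ?_ ?_
  · rw [hU]
    omega
  · intro i hi
    rw [Finset.mem_filter] at hi
    exact hγδ i hi.1 hi.2
  · intro a ha i hi
    rw [hU]
    rw [Finset.mem_filter] at hi
    -- This realizes h = a on the indices of nonzero slope. Where δ_l = 0 the quotient is 0 by
    -- convention, which is harmless since h_l does not depend on w_l.
    set w : Fin n → ℝ := fun l => (a l - γ l) / δ l
    have hwa : ∀ l ∈ A.erase i, ∀ t, γ l + δ l * update w i t l = a l := by
      intro l hl t
      rw [update_of_ne (Finset.ne_of_mem_erase hl)]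
      by_cases h0 : δ l = 0
      · rw [ha l (Finset.mem_filter.2 ⟨Finset.mem_of_mem_erase hl, h0⟩), h0]
        ring
      · simp only [w]
        field_simp
        ring
    have key : ∀ t, γ i * mixedSum k (A.erase i) β a w + mixedSum (k + 1) (A.erase i) β a w +
        t * elemSymm (k + 1) (A.erase i) a = 0 := by
      intro t
      have e := hG (update w i t)
      have hup : ∀ l ∈ A.erase i, update w i t l = w l :=
        fun l hl => update_of_ne (Finset.ne_of_mem_erase hl) _ _
      rw [mixedSum_erase hi.1, mixedSum_congr (fun l hl => hwa l hl t) hup,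
        mixedSum_congr (fun l hl => hwa l hl t) hup, elemSymm_congr (fun l hl => hwa l hl t),
        update_self, hi.2, zero_mul, add_zero] at e
      exact e
    linarith [key 0, key 1]

/-- The mixed sum of degree `k + 1` can vanish identically only if there are at most `k + 2`
indices. -/
theorem card_le_of_mixedSum_eq_zero
    (h1 : ∀ i ∈ A, ∃ v ∈ V i, v.1 ≠ 0) (h2 : ∀ i ∈ A, ∃ u ∈ V i, ∃ v ∈ V i, u.2 ≠ v.2)
    (hβ : ∀ i ∈ A, ∀ v ∈ V i, 0 < β + v.2)
    (hQ : ∀ h w : Fin n → ℝ, (∀ i ∈ A, (h i, w i) ∈ V i) → mixedSum (k + 1) A β h w = 0) :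
    A.card ≤ k + 2 := by
  induction hN : A.card using Nat.strong_induction_on generalizing A with
  | _ N ih =>
  by_contra! hlt
  have haff : ∀ i, ∃ γ δ : ℝ, i ∈ A → ∀ v ∈ V i, v.1 = γ + δ * v.2 := by
    intro i
    by_cases hi : i ∈ A
    swap
    · exact ⟨0, 0, fun h => absurd h hi⟩
    have hsub : ∀ l ∈ A.erase i, l ∈ A := fun l hl => Finset.mem_of_mem_erase hl
    have hcard : (A.erase i).card = N - 1 := by rw [Finset.card_erase_of_mem hi, hN]
    have key : ∀ h w : Fin n → ℝ, (∀ l ∈ A.erase i, (h l, w l) ∈ V l) → ∀ v ∈ V i,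
        v.1 * mixedSum k (A.erase i) β h w + mixedSum (k + 1) (A.erase i) β h w +
          v.2 * elemSymm (k + 1) (A.erase i) h = 0 := by
      intro h w hw v hv
      have e := hQ _ _ (update_mem_of_mem hw hv)
      have hup : ∀ (f : Fin n → ℝ) (t : ℝ), ∀ l ∈ A.erase i, update f i t l = f l :=
        fun f t l hl => update_of_ne (Finset.ne_of_mem_erase hl) _ _
      rwa [mixedSum_erase hi, update_self, update_self,
        mixedSum_congr (hup h _) (hup w _), mixedSum_congr (hup h _) (hup w _),
        elemSymm_congr (hup h _)] at e
    -- Either the two coefficients without h_i vanish for all values of the other variables, and the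
    -- induction hypothesis leaves exactly k + 2 other indices, a case already excluded; or some
    -- choice of values gives a genuine linear relation between h_i and w_i.
    by_cases hall : ∀ h w : Fin n → ℝ, (∀ l ∈ A.erase i, (h l, w l) ∈ V l) →
        mixedSum (k + 1) (A.erase i) β h w = 0 ∧ elemSymm (k + 1) (A.erase i) h = 0
    · exfalso
      have hle := ih (N - 1) (by omega) (fun l hl => h1 l (hsub l hl))
        (fun l hl => h2 l (hsub l hl)) (fun l hl => hβ l (hsub l hl))
        (fun h w hw => (hall h w hw).1) hcard
      exact false_of_mixedSum_of_elemSymm (by omega) (fun l hl => h1 l (hsub l hl))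
        (fun l hl => h2 l (hsub l hl)) (fun l hl => hβ l (hsub l hl))
        (fun h w hw => (hall h w hw).1) (fun h w hw => (hall h w hw).2)
    · push Not at hall
      obtain ⟨h, w, hw, hne⟩ := hall
      have hk := key h w hw
      set a := mixedSum k (A.erase i) β h w
      set b := mixedSum (k + 1) (A.erase i) β h w
      set d := elemSymm (k + 1) (A.erase i) h
      -- Without the h_i term, the two distinct values of w_i would force `d` and `b` to vanish too.
      have ha : a ≠ 0 := by
        intro ha
        obtain ⟨u, hu, v, hv, huv⟩ := h2 i hi
        have e1 := hk u hu
        have e2 := hk v hv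
        rw [ha] at e1 e2
        have hd : (u.2 - v.2) * d = 0 := by linarith
        have hd := (mul_eq_zero.1 hd).resolve_left (sub_ne_zero.2 huv)
        rw [hd] at e1
        exact hne (by linarith) hd
      refine ⟨-b / a, -d / a, fun _ v hv => ?_⟩
      have := hk v hv
      field_simp
      linarith
  choose γ δ hγδ using haff
  refine false_of_mixedSum_affine (k := k) (A := A) (β := β) (γ := γ) (δ := δ) (by omega) ?_ ?_
  · intro i hi h0 h0'
    obtain ⟨v, hv, hv0⟩ := h1 i hi
    have := hγδ i hi v hv
    rw [h0, h0'] at this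
    simp_all
  · refine eq_zero_of_affine_of_nontrivial (A := A) (S := fun i => Prod.snd '' V i)
      (G := fun w => mixedSum (k + 1) A β (fun i => γ i + δ i * w i) w) ?_ ?_ ?_
    · intro w i hi
      refine ⟨γ i * mixedSum k (A.erase i) β (fun i => γ i + δ i * w i) w +
        mixedSum (k + 1) (A.erase i) β (fun i => γ i + δ i * w i) w,
        δ i * mixedSum k (A.erase i) β (fun i => γ i + δ i * w i) w +
        elemSymm (k + 1) (A.erase i) (fun i => γ i + δ i * w i), fun t => ?_⟩
      have hup : ∀ l ∈ A.erase i, update w i t l = w l :=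
        fun l hl => update_of_ne (Finset.ne_of_mem_erase hl) _ _
      have hup' : ∀ l ∈ A.erase i, γ l + δ l * update w i t l = γ l + δ l * w l :=
        fun l hl => by rw [hup l hl]
      rw [mixedSum_erase hi, mixedSum_congr hup' hup, mixedSum_congr hup' hup,
        elemSymm_congr hup', update_self]
      ring
    · intro i hi
      obtain ⟨u, hu, v, hv, huv⟩ := h2 i hi
      exact ⟨u.2, ⟨u, hu, rfl⟩, v.2, ⟨v, hv, rfl⟩, huv⟩
    · intro w hw
      refine hQ _ _ fun i hi => ?_
      obtain ⟨v, hv, hvw⟩ := hw i hi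
      rw [← hvw, ← hγδ i hi v hv]
      exact hv

end Separation

/-! ### Characteristic polynomials and rank-one perturbations -/

section Determinant

open Polynomial

theorem det_diagonal_add_vecMulVec_field {K m : Type*} [Field K] [Fintype m] [DecidableEq m]
    (d u v : m → K) (hd : ∀ i, d i ≠ 0) :
    (Matrix.diagonal d + Matrix.vecMulVec u v).det =
      ∏ i, d i + ∑ j, u j * v j * ∏ i ∈ univ.erase j, d i := by
  have h1 : Matrix.diagonal d + Matrix.vecMulVec u v = Matrix.diagonal d *
      (1 + Matrix.replicateCol Unit (fun i => (d i)⁻¹ * u i) * Matrix.replicateRow Unit v) := by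
    ext i j
    rw [Matrix.diagonal_mul, Matrix.add_apply, Matrix.add_apply, Matrix.vecMulVec_apply,
      Matrix.mul_apply]
    by_cases hij : i = j
    · subst hij
      have := hd i
      simp
      field_simp
    · have := hd i
      simp [hij]
      field_simp
  rw [h1, Matrix.det_mul, Matrix.det_diagonal, Matrix.det_one_add_replicateCol_mul_replicateRow,
    dotProduct, mul_add, mul_one, Finset.mul_sum]
  congr 1
  refine Finset.sum_congr rfl fun j _ => ?_
  rw [← Finset.mul_prod_erase univ d (Finset.mem_univ j)]
  have := hd j
  field_simp

/-- Passing to the fraction field allows the diagonal to be inverted; the intended ring is ℝ[X],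
with diagonal entries X - κ_i. -/
theorem det_diagonal_add_vecMulVec {R m : Type*} [CommRing R] [IsDomain R] [Fintype m]
    [DecidableEq m] (d u v : m → R) (hd : ∀ i, d i ≠ 0) :
    (Matrix.diagonal d + Matrix.vecMulVec u v).det =
      ∏ i, d i + ∑ j, u j * v j * ∏ i ∈ univ.erase j, d i := by
  apply FaithfulSMul.algebraMap_injective R (FractionRing R)
  have h := det_diagonal_add_vecMulVec_field (fun i => algebraMap R (FractionRing R) (d i))
    (fun i => algebraMap R (FractionRing R) (u i)) (fun i => algebraMap R (FractionRing R) (v i))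
    fun i => by simpa using hd i
  simp only [map_add, map_sum, map_prod, map_mul]
  rw [← h, RingHom.map_det]
  congr 1
  ext i j
  by_cases hij : i = j
  · subst hij
    simp [Matrix.vecMulVec_apply]
  · simp [Matrix.vecMulVec_apply, hij]

theorem charpoly_inv_mul {m : Type*} [Fintype m] [DecidableEq m] {G H : Matrix m m ℝ}
    (hG : IsUnit G.det) :
    C G.det * (G⁻¹ * H).charpoly =
      ((X : ℝ[X]) • G.map (C : ℝ →+* ℝ[X]) - H.map (C : ℝ →+* ℝ[X])).det := by
  have h : (X : ℝ[X]) • G.map (C : ℝ →+* ℝ[X]) - H.map (C : ℝ →+* ℝ[X]) = G.map (C : ℝ →+* ℝ[X]) * (G⁻¹ * H).charmatrix := by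
    have hH : H.map (C : ℝ →+* ℝ[X]) = G.map C * (G⁻¹ * H).map C := by
      rw [← Matrix.map_mul, Matrix.mul_nonsing_inv_cancel_left G H hG]
    rw [Matrix.charmatrix, mul_sub, RingHom.mapMatrix_apply, ← hH, Matrix.scalar_apply,
      ← Matrix.smul_one_eq_diagonal, Matrix.mul_smul, mul_one]
  rw [h, Matrix.det_mul, Matrix.charpoly, RingHom.map_det, RingHom.mapMatrix_apply]

theorem charpoly_neg {m : Type*} [Fintype m] [DecidableEq m] (M : Matrix m m ℝ) :
    (-M).charpoly = (-1) ^ Fintype.card m * M.charpoly.comp (-X) := by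
  have h : (-M).charmatrix = -((compRingHom (-X : ℝ[X])).mapMatrix M.charmatrix) := by
    ext i j : 1
    by_cases hij : i = j
    · subst hij
      simp [Matrix.charmatrix_apply_eq, add_comm]
    · simp [Matrix.charmatrix_apply_ne _ _ _ hij]
  rw [Matrix.charpoly, h, Matrix.det_neg, ← RingHom.map_det]
  rfl

theorem coeff_charpoly_neg_eq_zero {m : Type*} [Fintype m] [DecidableEq m] {M : Matrix m m ℝ}
    {k : ℕ} (h : M.charpoly.coeff k = 0) : (-M).charpoly.coeff k = 0 := by
  have e : ((-1 : ℝ[X])) ^ Fintype.card m = C ((-1) ^ Fintype.card m) := by simp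
  rw [charpoly_neg, e, coeff_C_mul, show (-X : ℝ[X]) = C (-1) * X by simp, comp_C_mul_X_coeff, h]
  simp

variable {n : ℕ}

theorem coeff_prod_X_sub_C {k : ℕ} (s : Finset (Fin n)) (a : Fin n → ℝ) (hk : k ≤ s.card) :
    (∏ i ∈ s, (X - C (a i))).coeff (s.card - k) = (-1) ^ k * elemSymm k s a := by
  have h := Finset.prod_X_add_C_coeff s (fun i => -a i) (k := s.card - k) (Nat.sub_le _ _)
  simp only [map_neg, ← sub_eq_add_neg] at h
  rw [h, Nat.sub_sub_self hk, ← elemSymm_smul k s (-1) a]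
  simp [elemSymm]

/-- Multiplied by det(1 + ppᵀ), the characteristic polynomial becomes det(diag(X - κ_i) + X ppᵀ), to
which the determinant lemma applies. The factor X in the rank-one part lowers both the degree and
the coefficient index by one, so the same e_r appears there with one index removed. -/
theorem coeff_charpoly_rankOne {r : ℕ} (hr : r < n) (p κ : Fin n → ℝ) :
    (1 + ∑ i, p i ^ 2) * ((-1) ^ r *
      (((1 + Matrix.vecMulVec p p)⁻¹ * Matrix.diagonal κ).charpoly.coeff (n - r))) =
      mixedSum r univ 1 κ fun i => p i ^ 2 := by
  have hdet : (1 + Matrix.vecMulVec p p).det = 1 + ∑ i, p i ^ 2 := by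
    rw [← Matrix.diagonal_one, det_diagonal_add_vecMulVec _ _ _ fun _ => one_ne_zero]
    simp [sq]
  have hpos : 0 < 1 + ∑ i, p i ^ 2 := by positivity
  have h := charpoly_inv_mul (G := 1 + Matrix.vecMulVec p p) (H := Matrix.diagonal κ)
    (by rw [hdet]; exact hpos.ne'.isUnit)
  have hm : (X : ℝ[X]) • (1 + Matrix.vecMulVec p p).map (C : ℝ →+* ℝ[X]) -
      (Matrix.diagonal κ).map (C : ℝ →+* ℝ[X]) =
      Matrix.diagonal (fun i => X - C (κ i)) +
        Matrix.vecMulVec (fun i => X * C (p i)) (fun i => C (p i)) := by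
    ext i j : 1
    by_cases hij : i = j
    · subst hij
      simp [Matrix.vecMulVec_apply]
      ring
    · simp [Matrix.vecMulVec_apply, hij]
      ring
  rw [hm, hdet, det_diagonal_add_vecMulVec _ _ _ fun i => X_sub_C_ne_zero _] at h
  have hc := congrArg (fun q : ℝ[X] => (-1) ^ r * q.coeff (n - r)) h
  simp only [coeff_C_mul, coeff_add, finsetSum_coeff] at hc
  have h1 := coeff_prod_X_sub_C (k := r) univ κ (by simpa using hr.le)
  rw [Finset.card_univ, Fintype.card_fin] at h1
  have h2 : ∀ j : Fin n, (X * C (p j) * C (p j) * ∏ i ∈ univ.erase j, (X - C (κ i))).coeff (n - r) =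
      (-1) ^ r * (p j ^ 2 * elemSymm r (univ.erase j) κ) := by
    intro j
    have hcard : (univ.erase j : Finset (Fin n)).card = n - 1 := by simp
    have h3 := coeff_prod_X_sub_C (k := r) (univ.erase j) κ (by omega)
    have e : X * C (p j) * C (p j) * ∏ i ∈ univ.erase j, (X - C (κ i)) =
        X * (C (p j ^ 2) * ∏ i ∈ univ.erase j, (X - C (κ i))) := by
      rw [C_pow]
      ring
    rw [e, show n - r = (n - 1 - r) + 1 by omega, coeff_X_mul, coeff_C_mul, ← hcard, h3]
    ring
  have hsq : (-1 : ℝ) ^ r * (-1) ^ r = 1 := by rw [← mul_pow]; simp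
  rw [h1, Finset.sum_congr rfl fun j _ => h2 j, ← Finset.mul_sum, ← mul_add, ← mul_assoc _ ((-1) ^ r),
    hsq, one_mul] at hc
  rw [mixedSum, one_mul, ← hc]
  ring

end Determinant

/-! ### Fundamental forms of graphs and the equation S_r = 0 -/

section Graph

variable {n : ℕ}

/-- The splitting `ℝⁿ × ℝ ≃ ℝⁿ⁺¹`. -/
def snocEquiv (n : ℕ) : ((Fin n → ℝ) × ℝ) ≃L[ℝ] EuclideanSpace ℝ (Fin (n + 1)) :=
  LinearEquiv.toContinuousLinearEquiv
    { toFun := fun p => WithLp.toLp 2 (Fin.snoc (α := fun _ => ℝ) p.1 p.2)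
      invFun := fun z => (fun i => z i.castSucc, z (Fin.last n))
      map_add' := fun p q => by
        ext i
        refine Fin.lastCases ?_ (fun i => ?_) i <;> simp
      map_smul' := fun c p => by
        ext i
        refine Fin.lastCases ?_ (fun i => ?_) i <;> simp
      left_inv := fun p => by ext <;> simp
      right_inv := fun z => by
        ext i
        refine Fin.lastCases ?_ (fun i => ?_) i <;> simp }

theorem snocEquiv_apply (v : Fin n → ℝ) (a : ℝ) :
    snocEquiv n (v, a) = WithLp.toLp 2 (Fin.snoc (α := fun _ => ℝ) v a) := rfl

theorem graphParam_eq (F : (Fin n → ℝ) → ℝ) (x : Fin n → ℝ) :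
    graphParam F x = snocEquiv n (x, F x) := rfl

theorem inner_snocEquiv (v w : Fin n → ℝ) (a b : ℝ) :
    inner ℝ (snocEquiv n (v, a)) (snocEquiv n (w, b)) = ∑ i, v i * w i + a * b := by
  simp only [snocEquiv_apply, PiLp.inner_apply, Fin.sum_univ_castSucc]
  simp [mul_comm]

theorem graphNormal_eq (F : (Fin n → ℝ) → ℝ) (x : Fin n → ℝ) :
    graphNormal F x = (√(1 + ∑ i, partialDeriv i F x ^ 2))⁻¹ •
      snocEquiv n (fun i => -partialDeriv i F x, 1) := rfl

theorem hasFDerivAt_graphParam {F : (Fin n → ℝ) → ℝ} {x : Fin n → ℝ}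
    (h : DifferentiableAt ℝ F x) :
    HasFDerivAt (graphParam F) ((snocEquiv n : ((Fin n → ℝ) × ℝ) →L[ℝ] EuclideanSpace ℝ (Fin (n + 1))).comp
      ((ContinuousLinearMap.id ℝ (Fin n → ℝ)).prod (fderiv ℝ F x))) x :=
  (snocEquiv n).hasFDerivAt.comp x ((hasFDerivAt_id x).prodMk h.hasFDerivAt)

theorem fderiv_graphParam {F : (Fin n → ℝ) → ℝ} {x : Fin n → ℝ} (h : DifferentiableAt ℝ F x)
    (v : Fin n → ℝ) : fderiv ℝ (graphParam F) x v = snocEquiv n (v, fderiv ℝ F x v) := by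
  rw [(hasFDerivAt_graphParam h).fderiv]
  rfl

theorem firstForm_graphParam {F : (Fin n → ℝ) → ℝ} {x : Fin n → ℝ} (h : DifferentiableAt ℝ F x) :
    firstForm (graphParam F) x = 1 + Matrix.vecMulVec (fun i => partialDeriv i F x)
      (fun i => partialDeriv i F x) := by
  ext i j
  rw [firstForm, Matrix.of_apply, partialDeriv, partialDeriv, fderiv_graphParam h,
    fderiv_graphParam h, inner_snocEquiv, Matrix.add_apply, Matrix.vecMulVec_apply]
  simp [partialDeriv, Matrix.one_apply, Pi.single_apply, eq_comm]

theorem secondForm_graphParam {F : (Fin n → ℝ) → ℝ} {Ω : Set (Fin n → ℝ)} (hΩ : IsOpen Ω)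
    (hF : ContDiffOn ℝ ∞ F Ω) {x : Fin n → ℝ} (hx : x ∈ Ω) (i j : Fin n) :
    secondForm (graphParam F) (graphNormal F) x i j =
      (√(1 + ∑ i, partialDeriv i F x ^ 2))⁻¹ * partialDeriv i (partialDeriv j F) x := by
  have hd : ∀ y ∈ Ω, DifferentiableAt ℝ F y := fun y hy =>
    (hF.differentiableOn (by simp)).differentiableAt (hΩ.mem_nhds hy)
  have h1 : partialDeriv j (graphParam F) =ᶠ[nhds x]
      fun y => snocEquiv n (Pi.single j 1, partialDeriv j F y) := by
    filter_upwards [hΩ.mem_nhds hx] with y hy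
    exact fderiv_graphParam (hd y hy) _
  have hd2 : DifferentiableAt ℝ (partialDeriv j F) x := by
    have : DifferentiableAt ℝ (fderiv ℝ F) x :=
      ((hF.fderiv_of_isOpen hΩ (m := 1) (by norm_cast)).differentiableOn
        (by simp)).differentiableAt (hΩ.mem_nhds hx)
    exact this.clm_apply (differentiableAt_const _)
  have h2 : HasFDerivAt (fun y => snocEquiv n (Pi.single j 1, partialDeriv j F y))
      ((snocEquiv n : ((Fin n → ℝ) × ℝ) →L[ℝ] EuclideanSpace ℝ (Fin (n + 1))).comp
        ((0 : (Fin n → ℝ) →L[ℝ] (Fin n → ℝ)).prod (fderiv ℝ (partialDeriv j F) x))) x :=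
    (snocEquiv n).hasFDerivAt.comp x
      ((hasFDerivAt_const _ x).prodMk hd2.hasFDerivAt)
  have h3 : partialDeriv i (partialDeriv j (graphParam F)) x =
      snocEquiv n (0, partialDeriv i (partialDeriv j F) x) := by
    rw [partialDeriv, h1.fderiv_eq, h2.fderiv]
    rfl
  rw [secondForm, Matrix.of_apply, h3, graphNormal_eq, inner_smul_left, inner_snocEquiv]
  simp

theorem IsOpenInterval.isOpen_pi {J : Fin n → Set ℝ} (hJ : ∀ i, IsOpenInterval (J i)) :
    IsOpen (Set.univ.pi J) :=
  isOpen_set_pi Set.finite_univ fun i _ => (hJ i).1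

theorem contDiffOn_translationFun {J : Fin n → Set ℝ} {f : Fin n → ℝ → ℝ}
    (hf : ∀ i, ContDiffOn ℝ ∞ (f i) (J i)) :
    ContDiffOn ℝ ∞ (translationFun f) (Set.univ.pi J) := by
  refine ContDiffOn.sum fun i _ => ?_
  exact (hf i).comp (contDiff_apply ℝ ℝ i).contDiffOn fun x hx => hx i (Set.mem_univ i)

theorem partialDeriv_translationFun {J : Fin n → Set ℝ} (hJ : ∀ i, IsOpenInterval (J i))
    {f : Fin n → ℝ → ℝ} (hf : ∀ i, ContDiffOn ℝ ∞ (f i) (J i)) {x : Fin n → ℝ}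
    (hx : x ∈ Set.univ.pi J) (i : Fin n) :
    partialDeriv i (translationFun f) x = deriv (f i) (x i) := by
  have h : ∀ l, HasDerivAt (f l) (deriv (f l) (x l)) (x l) := fun l =>
    (((hf l).differentiableOn (by simp)).differentiableAt
      ((hJ l).1.mem_nhds (hx l (Set.mem_univ l)))).hasDerivAt
  have h' : HasFDerivAt (translationFun f) (∑ l, deriv (f l) (x l) •
      (ContinuousLinearMap.proj l : (Fin n → ℝ) →L[ℝ] ℝ)) x :=
    HasFDerivAt.fun_sum fun l _ => (h l).comp_hasFDerivAt x (hasFDerivAt_apply l x)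
  rw [partialDeriv, h'.fderiv]
  simp [Pi.single_apply]

theorem partialDeriv_partialDeriv_translationFun {J : Fin n → Set ℝ}
    (hJ : ∀ i, IsOpenInterval (J i)) {f : Fin n → ℝ → ℝ} (hf : ∀ i, ContDiffOn ℝ ∞ (f i) (J i))
    {x : Fin n → ℝ} (hx : x ∈ Set.univ.pi J) (i j : Fin n) :
    partialDeriv i (partialDeriv j (translationFun f)) x =
      if i = j then deriv (deriv (f j)) (x j) else 0 := by
  have h1 : partialDeriv j (translationFun f) =ᶠ[nhds x] fun y => deriv (f j) (y j) := by
    filter_upwards [(IsOpenInterval.isOpen_pi hJ).mem_nhds hx] with y hy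
    exact partialDeriv_translationFun hJ hf hy j
  have h2 : HasDerivAt (deriv (f j)) (deriv (deriv (f j)) (x j)) (x j) :=
    ((((hf j).deriv_of_isOpen (hJ j).1 (m := 1) (by norm_cast)).differentiableOn
      (by simp)).differentiableAt ((hJ j).1.mem_nhds (hx j (Set.mem_univ j)))).hasDerivAt
  have h3 : HasFDerivAt (fun y : Fin n → ℝ => deriv (f j) (y j)) (deriv (deriv (f j)) (x j) •
      (ContinuousLinearMap.proj j : (Fin n → ℝ) →L[ℝ] ℝ)) x :=
    HasDerivAt.comp_hasFDerivAt (f := fun y : Fin n → ℝ => y j) x h2 (hasFDerivAt_apply j x)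
  rw [partialDeriv, h1.fderiv_eq, h3.fderiv]
  simp [Pi.single_apply, eq_comm]

/-- The equation `S_r = 0` for a translation hypersurface. -/
theorem graphCurvature_translationFun_eq_zero_iff {r : ℕ} (hr : r < n) {J : Fin n → Set ℝ}
    (hJ : ∀ i, IsOpenInterval (J i)) {f : Fin n → ℝ → ℝ} (hf : ∀ i, ContDiffOn ℝ ∞ (f i) (J i))
    {x : Fin n → ℝ} (hx : x ∈ Set.univ.pi J) :
    graphCurvature r (translationFun f) x = 0 ↔
      mixedSum r univ 1 (fun i => deriv (deriv (f i)) (x i))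
        (fun i => deriv (f i) (x i) ^ 2) = 0 := by
  have hF := contDiffOn_translationFun hf
  have hΩ := IsOpenInterval.isOpen_pi hJ
  set W := √(1 + ∑ i, deriv (f i) (x i) ^ 2) with hW
  have hWpos : 0 < W := Real.sqrt_pos.2 (by positivity)
  have hpos : 0 < 1 + ∑ i, deriv (f i) (x i) ^ 2 := by positivity
  have h2 : secondForm (graphParam (translationFun f)) (graphNormal (translationFun f)) x =
      Matrix.diagonal fun i => W⁻¹ * deriv (deriv (f i)) (x i) := by
    ext i j
    rw [secondForm_graphParam hΩ hF hx, partialDeriv_partialDeriv_translationFun hJ hf hx]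
    simp only [partialDeriv_translationFun hJ hf hx, ← hW]
    by_cases hij : i = j
    · subst hij
      simp
    · simp [hij]
  have h := coeff_charpoly_rankOne hr (fun i => deriv (f i) (x i))
    (fun i => W⁻¹ * deriv (deriv (f i)) (x i))
  -- The mixed sum is homogeneous of degree r in h, so the normalization of the normal contributes
  -- only a positive factor.
  have hmix : mixedSum r univ 1 (fun i => W⁻¹ * deriv (deriv (f i)) (x i))
      (fun i => deriv (f i) (x i) ^ 2) = W⁻¹ ^ r *
        mixedSum r univ 1 (fun i => deriv (deriv (f i)) (x i))
          (fun i => deriv (f i) (x i) ^ 2) := by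
    simp only [mixedSum, elemSymm_smul, mul_add, Finset.mul_sum]
    congr 1
    · ring
    · exact Finset.sum_congr rfl fun i _ => by ring
  have hd : DifferentiableAt ℝ (translationFun f) x :=
    (hF.differentiableOn (by simp)).differentiableAt (hΩ.mem_nhds hx)
  rw [graphCurvature, curvature, shapeMatrix, firstForm_graphParam hd, h2]
  simp only [partialDeriv_translationFun hJ hf hx]
  rw [hmix] at h
  have hWr : W⁻¹ ^ r ≠ 0 := by positivity
  constructor
  · intro h0
    rw [h0, mul_zero] at h
    exact (mul_eq_zero.1 h.symm).resolve_left hWr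
  · intro h0
    rw [h0, mul_zero] at h
    exact (mul_eq_zero.1 h).resolve_left hpos.ne'

end Graph

/-! ### Invariance of S_r = 0 under isometries -/

section Invariance

variable {n : ℕ}

theorem contDiffOn_graphParam {F : (Fin n → ℝ) → ℝ} {Ω : Set (Fin n → ℝ)}
    (hF : ContDiffOn ℝ ∞ F Ω) : ContDiffOn ℝ ∞ (graphParam F) Ω :=
  (snocEquiv n).contDiff.comp_contDiffOn (contDiffOn_id.prodMk hF)

theorem norm_graphNormal (F : (Fin n → ℝ) → ℝ) (x : Fin n → ℝ) : ‖graphNormal F x‖ = 1 := by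
  have hpos : 0 < 1 + ∑ i, partialDeriv i F x ^ 2 := by positivity
  have h : ‖snocEquiv n (fun i => -partialDeriv i F x, 1)‖ =
      √(1 + ∑ i, partialDeriv i F x ^ 2) := by
    rw [norm_eq_sqrt_real_inner, inner_snocEquiv]
    congr 1
    rw [add_comm]
    simp [sq]
  have hs := Real.sqrt_pos.2 hpos
  rw [graphNormal_eq, norm_smul, h, norm_inv, Real.norm_of_nonneg hs.le, inv_mul_cancel₀ hs.ne']

theorem fderiv_apply_eq_sum (F : (Fin n → ℝ) → ℝ) (x v : Fin n → ℝ) :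
    fderiv ℝ F x v = ∑ i, v i * partialDeriv i F x := by
  conv_lhs => rw [pi_eq_sum_univ' v]
  rw [map_sum]
  refine Finset.sum_congr rfl fun i _ => ?_
  rw [map_smul, smul_eq_mul]
  rfl

theorem inner_graphNormal_fderiv {F : (Fin n → ℝ) → ℝ} {x : Fin n → ℝ}
    (h : DifferentiableAt ℝ F x) (v : Fin n → ℝ) :
    inner ℝ (graphNormal F x) (fderiv ℝ (graphParam F) x v) = 0 := by
  have hs : ∑ i, -partialDeriv i F x * v i + 1 * fderiv ℝ F x v = 0 := by
    rw [fderiv_apply_eq_sum, one_mul, ← Finset.sum_add_distrib]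
    exact Finset.sum_eq_zero fun i _ => by ring
  rw [fderiv_graphParam h, graphNormal_eq, inner_smul_left, inner_snocEquiv, hs, mul_zero]

/-- A vector orthogonal to the tangent space of a graph is a multiple of the normal. -/
theorem exists_eq_smul_graphNormal {F : (Fin n → ℝ) → ℝ} {x : Fin n → ℝ}
    (h : DifferentiableAt ℝ F x) {z : EuclideanSpace ℝ (Fin (n + 1))}
    (hz : ∀ v, inner ℝ z (fderiv ℝ (graphParam F) x v) = 0) : ∃ c : ℝ, z = c • graphNormal F x := by
  obtain ⟨⟨u, a⟩, rfl⟩ := (snocEquiv n).surjective z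
  have hu : ∀ i, u i = a * -partialDeriv i F x := by
    intro i
    have := hz (Pi.single i 1)
    rw [fderiv_graphParam h, inner_snocEquiv] at this
    simp only [Pi.single_apply, mul_ite, mul_one, mul_zero, Finset.sum_ite_eq',
      Finset.mem_univ, if_true] at this
    change u i + a * partialDeriv i F x = 0 at this
    linarith
  have hpos : 0 < 1 + ∑ i, partialDeriv i F x ^ 2 := by positivity
  have hs := (Real.sqrt_pos.2 hpos).ne'
  refine ⟨a * √(1 + ∑ i, partialDeriv i F x ^ 2), ?_⟩
  rw [graphNormal_eq, smul_smul, mul_assoc, mul_inv_cancel₀ hs, mul_one, ← map_smul]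
  congr 1
  ext i
  · simpa using hu i
  · simp

theorem charpoly_conj_of_isUnit {m : Type*} [Fintype m] [DecidableEq m] {P M : Matrix m m ℝ}
    (hP : IsUnit P.det) : (P⁻¹ * M * P).charpoly = M.charpoly := by
  rw [Matrix.charpoly_mul_comm, ← mul_assoc, Matrix.mul_nonsing_inv P hP, one_mul]

theorem fderiv_apply_sum_single {E : Type*} [NormedAddCommGroup E] [NormedSpace ℝ E]
    (T : (Fin n → ℝ) →L[ℝ] E) (v : Fin n → ℝ) : T v = ∑ i, v i • T (Pi.single i 1) := by
  conv_lhs => rw [pi_eq_sum_univ' v]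
  simp

theorem partialDeriv_partialDeriv {E : Type*} [NormedAddCommGroup E] [NormedSpace ℝ E]
    {X : (Fin n → ℝ) → E} {x : Fin n → ℝ} (h : DifferentiableAt ℝ (fderiv ℝ X) x) (i j : Fin n) :
    partialDeriv i (partialDeriv j X) x =
      fderiv ℝ (fderiv ℝ X) x (Pi.single i 1) (Pi.single j 1) := by
  have h1 := (h.hasFDerivAt.clm_apply (hasFDerivAt_const (Pi.single j 1) x)).fderiv
  have h2 := DFunLike.congr_fun h1 (Pi.single i 1)
  simp only [ContinuousLinearMap.comp_zero, zero_add, ContinuousLinearMap.flip_apply] at h2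
  exact h2

/-- The vanishing of `S_r` is invariant under isometries of the ambient space. -/
theorem graphCurvature_eq_zero_of_isometry {r : ℕ} {F G : (Fin n → ℝ) → ℝ}
    {Ω Ω' : Set (Fin n → ℝ)} (hΩ : IsOpen Ω) (hΩ' : IsOpen Ω') (hF : ContDiffOn ℝ ∞ F Ω)
    (hG : ContDiffOn ℝ ∞ G Ω')
    (φ : EuclideanSpace ℝ (Fin (n + 1)) ≃ᵢ EuclideanSpace ℝ (Fin (n + 1)))
    (hφ : φ '' graphOver F Ω ⊆ graphOver G Ω') (hcurv : ∀ y ∈ Ω', graphCurvature r G y = 0)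
    {x : Fin n → ℝ} (hx : x ∈ Ω) : graphCurvature r F x = 0 := by
  set ψ := φ.toRealAffineIsometryEquiv with hψ
  set L := ψ.linearIsometryEquiv
  have hψL : ∀ z, φ z = L z + φ 0 := by
    intro z
    have := ψ.map_vadd 0 z
    simpa [hψ] using this
  set X := graphParam F with hX
  set Y := graphParam G with hY
  -- The change of parameters induced by φ: since the image lies in a graph, its base point is read
  -- off by projection, which makes `y` smooth.
  set y : (Fin n → ℝ) → (Fin n → ℝ) := fun z => ((snocEquiv n).symm (φ (X z))).1 with hy
  have hyY : ∀ z ∈ Ω, y z ∈ Ω' ∧ Y (y z) = L (X z) + φ 0 := by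
    intro z hz
    obtain ⟨u, hu, hu'⟩ := hφ ⟨X z, ⟨z, hz, rfl⟩, rfl⟩
    have hyu : y z = u := by
      rw [hy]
      dsimp only
      rw [← hu', graphParam_eq, ContinuousLinearEquiv.symm_apply_apply]
    rw [hyu, ← hψL]
    exact ⟨hu, hu'⟩
  have hXs : ContDiffOn ℝ ∞ X Ω := contDiffOn_graphParam hF
  have hYs : ContDiffOn ℝ ∞ Y Ω' := contDiffOn_graphParam hG
  have hys : ContDiffOn ℝ ∞ y Ω := by
    have : ContDiffOn ℝ ∞ (fun z => ((snocEquiv n).symm (L (X z) + φ 0)).1) Ω :=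
      (contDiff_fst.comp (snocEquiv n).symm.contDiff).comp_contDiffOn
        ((L.contDiff.comp_contDiffOn hXs).add contDiffOn_const)
    exact this.congr fun z _ => by rw [hy]; dsimp only; rw [hψL]
  have hdF : ∀ z ∈ Ω, DifferentiableAt ℝ F z := fun z hz =>
    (hF.differentiableOn (by simp)).differentiableAt (hΩ.mem_nhds hz)
  have hdX : ∀ z ∈ Ω, DifferentiableAt ℝ X z := fun z hz =>
    (hXs.differentiableOn (by simp)).differentiableAt (hΩ.mem_nhds hz)
  have hdy : ∀ z ∈ Ω, DifferentiableAt ℝ y z := fun z hz =>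
    (hys.differentiableOn (by simp)).differentiableAt (hΩ.mem_nhds hz)
  have hdG : ∀ z ∈ Ω', DifferentiableAt ℝ G z := fun z hz =>
    (hG.differentiableOn (by simp)).differentiableAt (hΩ'.mem_nhds hz)
  have hdY : ∀ z ∈ Ω', DifferentiableAt ℝ Y z := fun z hz =>
    (hYs.differentiableOn (by simp)).differentiableAt (hΩ'.mem_nhds hz)
  have hdX' : DifferentiableAt ℝ (fderiv ℝ X) x :=
    ((hXs.fderiv_of_isOpen hΩ (m := 1) (by norm_cast)).differentiableOn
      (by simp)).differentiableAt (hΩ.mem_nhds hx)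
  have hdy' : DifferentiableAt ℝ (fderiv ℝ y) x :=
    ((hys.fderiv_of_isOpen hΩ (m := 1) (by norm_cast)).differentiableOn
      (by simp)).differentiableAt (hΩ.mem_nhds hx)
  have hdY' : DifferentiableAt ℝ (fderiv ℝ Y) (y x) :=
    ((hYs.fderiv_of_isOpen hΩ' (m := 1) (by norm_cast)).differentiableOn
      (by simp)).differentiableAt (hΩ'.mem_nhds (hyY x hx).1)
  have hfirst : ∀ z ∈ Ω, ∀ v, fderiv ℝ Y (y z) (fderiv ℝ y z v) = L (fderiv ℝ X z v) := by
    intro z hz v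
    have h1 : HasFDerivAt (fun u => Y (y u)) ((fderiv ℝ Y (y z)).comp (fderiv ℝ y z)) z :=
      (hdY _ (hyY z hz).1).hasFDerivAt.comp z (hdy z hz).hasFDerivAt
    have h2 : HasFDerivAt (fun u => L (X u) + φ 0)
        (((L : EuclideanSpace ℝ (Fin (n + 1)) →L[ℝ] EuclideanSpace ℝ (Fin (n + 1)))).comp
          (fderiv ℝ X z)) z :=
      (((L : EuclideanSpace ℝ (Fin (n + 1)) →L[ℝ]
        EuclideanSpace ℝ (Fin (n + 1))).hasFDerivAt).comp z (hdX z hz).hasFDerivAt).add_const _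
    have h3 := h1.congr_of_eventuallyEq (f₁ := fun u => L (X u) + φ 0) (by
      filter_upwards [hΩ.mem_nhds hz] with u hu
      exact (hyY u hu).2.symm)
    exact DFunLike.congr_fun (h3.unique h2) v
  have hsecond : ∀ v w, fderiv ℝ (fderiv ℝ Y) (y x) (fderiv ℝ y x v) (fderiv ℝ y x w) +
      fderiv ℝ Y (y x) (fderiv ℝ (fderiv ℝ y) x v w) = L (fderiv ℝ (fderiv ℝ X) x v w) := by
    intro v w
    have h1 := (hdY'.hasFDerivAt.comp x (hdy x hx).hasFDerivAt).clm_apply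
      (hdy'.hasFDerivAt.clm_apply (hasFDerivAt_const w x))
    have h2 : HasFDerivAt (fun u => L (fderiv ℝ X u w)) _ x :=
      (L : EuclideanSpace ℝ (Fin (n + 1)) →L[ℝ] EuclideanSpace ℝ (Fin (n + 1))).hasFDerivAt.comp x
        (hdX'.hasFDerivAt.clm_apply (hasFDerivAt_const w x))
    have h3 := h1.congr_of_eventuallyEq (f₁ := fun u => L (fderiv ℝ X u w)) (by
      filter_upwards [hΩ.mem_nhds hx] with u hu
      exact (hfirst u hu w).symm)
    have h4 := DFunLike.congr_fun (h3.unique h2) v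
    simp at h4
    rw [← h4]
    exact add_comm _ _
  obtain ⟨c, hc⟩ : ∃ c : ℝ, L.symm (graphNormal G (y x)) = c • graphNormal F x := by
    refine exists_eq_smul_graphNormal (hdF x hx) fun v => ?_
    rw [← L.inner_map_map, L.apply_symm_apply, ← hfirst x hx]
    exact inner_graphNormal_fderiv (hdG _ (hyY x hx).1) _
  -- The isometry may reverse the chosen orientation, so the normals agree only up to sign.
  have hc2 : c = 1 ∨ c = -1 := by
    have := congrArg norm hc
    rw [L.symm.norm_map, norm_smul, norm_graphNormal, norm_graphNormal, mul_one] at this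
    exact eq_or_eq_neg_of_abs_eq this.symm
  set P : Matrix (Fin n) (Fin n) ℝ := Matrix.of fun i j => fderiv ℝ y x (Pi.single j 1) i with hP
  have hPv : ∀ v, P.mulVec v = fderiv ℝ y x v := by
    intro v
    ext i
    rw [fderiv_apply_sum_single (fderiv ℝ y x) v, Finset.sum_apply, Matrix.mulVec, dotProduct]
    exact Finset.sum_congr rfl fun j _ => by simp [hP, mul_comm]
  have hPu : IsUnit P.det := by
    rw [← Matrix.isUnit_iff_isUnit_det, ← Matrix.mulVec_injective_iff_isUnit]
    rw [← Matrix.coe_mulVecLin, ← LinearMap.ker_eq_bot, LinearMap.ker_eq_bot']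
    intro v hv
    rw [Matrix.mulVecLin_apply, hPv] at hv
    have h := hfirst x hx v
    rw [hv, map_zero, eq_comm, map_eq_zero_iff L L.injective, hX, fderiv_graphParam (hdF x hx),
      map_eq_zero_iff (snocEquiv n) (snocEquiv n).injective] at h
    exact congrArg Prod.fst h
  have hI : firstForm X x = P.transpose * firstForm Y (y x) * P := by
    ext i j
    rw [firstForm, Matrix.of_apply, partialDeriv, partialDeriv, ← L.inner_map_map,
      ← hfirst x hx, ← hfirst x hx, fderiv_apply_sum_single (fderiv ℝ Y (y x)),
      fderiv_apply_sum_single (fderiv ℝ Y (y x)) (fderiv ℝ y x (Pi.single j 1)),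
      sum_inner, Matrix.mul_assoc, Matrix.mul_apply]
    refine Finset.sum_congr rfl fun k _ => ?_
    rw [inner_smul_left, inner_sum, Matrix.mul_apply]
    congr 1
    refine Finset.sum_congr rfl fun l _ => ?_
    rw [inner_smul_right, mul_comm]
    rfl
  have hIIX : ∀ i j, partialDeriv i (partialDeriv j X) x =
      fderiv ℝ (fderiv ℝ X) x (Pi.single i 1) (Pi.single j 1) :=
    fun i j => partialDeriv_partialDeriv hdX' i j
  have hIIY : ∀ i j, partialDeriv i (partialDeriv j Y) (y x) =
      fderiv ℝ (fderiv ℝ Y) (y x) (Pi.single i 1) (Pi.single j 1) :=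
    fun i j => partialDeriv_partialDeriv hdY' i j
  -- The term with the second derivative of `y` in `hsecond` is tangent, so the normal annihilates
  -- it.
  have hII : c • secondForm X (graphNormal F) x =
      P.transpose * secondForm Y (graphNormal G) (y x) * P := by
    ext i j
    rw [Matrix.smul_apply, secondForm, Matrix.of_apply, hIIX, smul_eq_mul,
      ← real_inner_smul_left, ← hc, ← L.inner_map_map, L.apply_symm_apply, ← hsecond,
      inner_add_right, inner_graphNormal_fderiv (hdG _ (hyY x hx).1), add_zero,
      fderiv_apply_sum_single (fderiv ℝ (fderiv ℝ Y) (y x)), _root_.sum_apply,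
      inner_sum, Matrix.mul_assoc, Matrix.mul_apply]
    refine Finset.sum_congr rfl fun k _ => ?_
    rw [_root_.smul_apply, inner_smul_right, Matrix.mul_apply,
      fderiv_apply_sum_single (fderiv ℝ (fderiv ℝ Y) (y x) (Pi.single k 1)), inner_sum]
    congr 1
    refine Finset.sum_congr rfl fun l _ => ?_
    rw [inner_smul_right, mul_comm, ← hIIY]
    rfl
  have hS : c • shapeMatrix X (graphNormal F) x = P⁻¹ * shapeMatrix Y (graphNormal G) (y x) * P := by
    have hPt : IsUnit P.transpose.det := by rwa [Matrix.det_transpose]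
    rw [shapeMatrix, ← Matrix.mul_smul, hII, hI, Matrix.mul_inv_rev, Matrix.mul_inv_rev, shapeMatrix]
    simp only [Matrix.mul_assoc]
    rw [Matrix.nonsing_inv_mul_cancel_left _ _ hPt]
  have h0 : (c • shapeMatrix X (graphNormal F) x).charpoly.coeff (n - r) = 0 := by
    rw [hS, charpoly_conj_of_isUnit hPu]
    have := hcurv (y x) (hyY x hx).1
    rw [graphCurvature, curvature] at this
    exact (mul_eq_zero.1 this).resolve_left (by simp)
  rw [graphCurvature, curvature, ← hX]
  rcases hc2 with rfl | rfl
  · rw [one_smul] at h0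
    rw [h0, mul_zero]
  · rw [neg_smul, one_smul] at h0
    have := coeff_charpoly_neg_eq_zero h0
    rw [neg_neg] at this
    rw [this, mul_zero]

end Invariance

/-! ### One-variable calculus and the equation f'' = a (β + f'²) -/

section OneVariable

theorem IsOpenInterval.isPreconnected {J : Set ℝ} (hJ : IsOpenInterval J) : IsPreconnected J :=
  hJ.2.1.isPreconnected

theorem hasDerivAt_of_contDiffOn {J : Set ℝ} (hJ : IsOpen J) {f : ℝ → ℝ}
    (hf : ContDiffOn ℝ ∞ f J) {t : ℝ} (ht : t ∈ J) : HasDerivAt f (deriv f t) t :=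
  ((hf.differentiableOn (by simp)).differentiableAt (hJ.mem_nhds ht)).hasDerivAt

theorem hasDerivAt_deriv_of_contDiffOn {J : Set ℝ} (hJ : IsOpen J) {f : ℝ → ℝ}
    (hf : ContDiffOn ℝ ∞ f J) {t : ℝ} (ht : t ∈ J) : HasDerivAt (deriv f) (deriv (deriv f) t) t :=
  (((hf.deriv_of_isOpen hJ (m := 1) (by norm_cast)).differentiableOn
      (by simp)).differentiableAt (hJ.mem_nhds ht)).hasDerivAt

theorem IsOpenInterval.exists_const_of_hasDerivAt_zero {J : Set ℝ} (hJ : IsOpenInterval J)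
    {u : ℝ → ℝ} (hu : ∀ t ∈ J, HasDerivAt u 0 t) : ∃ d, ∀ t ∈ J, u t = d :=
  hJ.1.exists_is_const_of_deriv_eq_zero hJ.isPreconnected
    (fun t ht => (hu t ht).differentiableAt.differentiableWithinAt) fun t ht => (hu t ht).deriv

theorem exists_affine_of_deriv_deriv_eq_zero {J : Set ℝ} (hJ : IsOpenInterval J) {f : ℝ → ℝ}
    (hf : ContDiffOn ℝ ∞ f J) (h : ∀ t ∈ J, deriv (deriv f) t = 0) :
    ∃ a d : ℝ, ∀ t ∈ J, f t = a * t + d ∧ deriv f t = a := by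
  obtain ⟨a, ha⟩ := hJ.exists_const_of_hasDerivAt_zero (u := deriv f) fun t ht => by
    rw [← h t ht]
    exact hasDerivAt_deriv_of_contDiffOn hJ.1 hf ht
  obtain ⟨d, hd⟩ := hJ.exists_const_of_hasDerivAt_zero (u := fun t => f t - a * t) fun t ht => by
    have h1 := (hasDerivAt_of_contDiffOn hJ.1 hf ht).sub ((hasDerivAt_id t).const_mul a)
    rw [ha t ht] at h1
    convert! h1 using 1
    ring
  exact ⟨a, d, fun t ht => ⟨by linarith [hd t ht], ha t ht⟩⟩

/-- If f'² were constant, then f' f'' = 0; at a point with f'' ≠ 0 this gives f' = 0, so the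
constant is 0, f' vanishes throughout, and f'' = 0 there after all. -/
theorem exists_sq_deriv_ne {J : Set ℝ} (hJ : IsOpenInterval J) {f : ℝ → ℝ}
    (hf : ContDiffOn ℝ ∞ f J) (h : ∃ t ∈ J, deriv (deriv f) t ≠ 0) :
    ∃ s ∈ J, ∃ t ∈ J, deriv f s ^ 2 ≠ deriv f t ^ 2 := by
  by_contra! hc
  obtain ⟨t, ht, hne⟩ := h
  have h1 := (hasDerivAt_deriv_of_contDiffOn hJ.1 hf ht).pow 2
  have h2 : HasDerivAt (fun s => deriv f s ^ 2) 0 t := by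
    refine (hasDerivAt_const t (deriv f t ^ 2)).congr_of_eventuallyEq ?_
    filter_upwards [hJ.1.mem_nhds ht] with s hs
    exact hc s hs t ht
  have h3 := h1.unique h2
  have h4 : deriv f t = 0 := by simpa [hne] using h3
  apply hne
  have h5 : deriv f =ᶠ[nhds t] fun _ => 0 := by
    filter_upwards [hJ.1.mem_nhds ht] with s hs
    have := hc s hs t ht
    rw [h4] at this
    simpa using this
  rw [h5.deriv_eq, deriv_const]

theorem cos_pos_of_abs_lt {θ : ℝ} (h : |θ| < Real.pi / 2) : 0 < Real.cos θ :=
  Real.cos_pos_of_mem_Ioo (abs_lt.1 h)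

theorem hasDerivAt_log_cos {a β b t : ℝ} (ha : a ≠ 0) (h : |a * √β * t + b| < Real.pi / 2) :
    HasDerivAt (fun t => -a⁻¹ * Real.log (Real.cos (a * √β * t + b)))
      (√β * Real.tan (a * √β * t + b)) t := by
  have hc := cos_pos_of_abs_lt h
  have h1 : HasDerivAt (fun t => a * √β * t + b) (a * √β) t := by
    simpa using ((hasDerivAt_id t).const_mul (a * √β)).add_const b
  have h2 := (h1.cos.log hc.ne').const_mul (-a⁻¹)
  convert! h2 using 1
  rw [Real.tan_eq_sin_div_cos]
  field_simp

theorem hasDerivAt_tan_linear {a β b t : ℝ} (hβ : 0 < β)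
    (h : |a * √β * t + b| < Real.pi / 2) :
    HasDerivAt (fun t => √β * Real.tan (a * √β * t + b))
      (a * (β + (√β * Real.tan (a * √β * t + b)) ^ 2)) t := by
  have hc := cos_pos_of_abs_lt h
  have h1 : HasDerivAt (fun t => a * √β * t + b) (a * √β) t := by
    simpa using ((hasDerivAt_id t).const_mul (a * √β)).add_const b
  have h2 := ((Real.hasDerivAt_tan hc.ne').comp t h1).const_mul √β
  convert! h2 using 1
  have h3 := Real.inv_one_add_tan_sq hc.ne'
  rw [← h3, one_div, inv_inv]
  have h4 := Real.sq_sqrt hβ.le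
  linear_combination (a * Real.tan (a * √β * t + b) ^ 2) * h4 -
    (a * (1 + Real.tan (a * √β * t + b) ^ 2)) * h4

theorem contDiffOn_log_cos {a β b : ℝ} {K : Set ℝ}
    (h : ∀ t ∈ K, |a * √β * t + b| < Real.pi / 2) :
    ContDiffOn ℝ ∞ (fun t => -a⁻¹ * Real.log (Real.cos (a * √β * t + b))) K := by
  refine contDiffOn_const.mul (ContDiffOn.log ?_ fun t ht => (cos_pos_of_abs_lt (h t ht)).ne')
  exact (Real.contDiff_cos.comp (by fun_prop)).contDiffOn

/-- Solutions of `f'' = a (β + f' ^ 2)`. -/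
theorem exists_log_cos_of_deriv_deriv_eq {J : Set ℝ} (hJ : IsOpenInterval J) {f : ℝ → ℝ}
    (hf : ContDiffOn ℝ ∞ f J) {a β : ℝ} (ha : a ≠ 0) (hβ : 0 < β)
    (h : ∀ t ∈ J, deriv (deriv f) t = a * (β + deriv f t ^ 2)) :
    ∃ b d : ℝ, ∀ t ∈ J, |a * √β * t + b| < Real.pi / 2 ∧
      f t = -a⁻¹ * Real.log (Real.cos (a * √β * t + b)) + d := by
  have hs : 0 < √β := Real.sqrt_pos.2 hβ
  have hsq := Real.sq_sqrt hβ.le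
  -- The ODE says that arctan(f'/√β) has constant derivative a√β. The phase is thus a value of
  -- arctan, which confines it to (-π/2, π/2) on all of `J`.
  obtain ⟨b, hb⟩ := hJ.exists_const_of_hasDerivAt_zero
    (u := fun t => Real.arctan (deriv f t / √β) - a * √β * t) fun t ht => by
      have h1 := (((hasDerivAt_deriv_of_contDiffOn hJ.1 hf ht).div_const √β).arctan).sub
        ((hasDerivAt_id t).const_mul (a * √β))
      convert! h1 using 1
      have hpos : 0 < β + deriv f t ^ 2 := by positivity
      rw [h t ht, div_pow, hsq]
      field_simp
      rw [hsq]
      ring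
  have harg : ∀ t ∈ J, a * √β * t + b = Real.arctan (deriv f t / √β) := fun t ht => by
    linarith [hb t ht]
  have habs : ∀ t ∈ J, |a * √β * t + b| < Real.pi / 2 := fun t ht => by
    rw [harg t ht, abs_lt]
    exact ⟨Real.neg_pi_div_two_lt_arctan _, Real.arctan_lt_pi_div_two _⟩
  obtain ⟨d, hd⟩ := hJ.exists_const_of_hasDerivAt_zero
    (u := fun t => f t - -a⁻¹ * Real.log (Real.cos (a * √β * t + b))) fun t ht => by
      have h1 := (hasDerivAt_of_contDiffOn hJ.1 hf ht).sub (hasDerivAt_log_cos ha (habs t ht))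
      have h2 : deriv f t - √β * Real.tan (a * √β * t + b) = 0 := by
        rw [harg t ht, Real.tan_arctan]
        field_simp
        ring
      rwa [h2] at h1
  exact ⟨b, d, fun t ht => ⟨habs t ht, by linarith [hd t ht]⟩⟩

end OneVariable

/-! ### Reordering the variables -/

section Indices

variable {n : ℕ}

theorem card_filter_le_val_add {m : ℕ} (hm : m ≤ n) :
    (univ.filter fun i : Fin n => n ≤ i.val + m).card = m := by
  have h1 := Finset.card_filter_add_card_filter_not (s := (univ : Finset (Fin n)))
    (fun i : Fin n => i.val < n - m)
  have h2 : (univ.filter fun i : Fin n => ¬ i.val < n - m) =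
      univ.filter fun i : Fin n => n ≤ i.val + m :=
    Finset.filter_congr fun i _ => by omega
  rw [Fin.card_filter_val_lt, h2, Finset.card_univ, Fintype.card_fin] at h1
  omega

theorem exists_perm_mem_iff {m : ℕ} {A : Finset (Fin n)} (hA : A.card = m) :
    ∃ σ : Equiv.Perm (Fin n), ∀ i, σ i ∈ A ↔ n ≤ i.val + m := by
  have hm : m ≤ n := by
    rw [← hA]
    simpa using Finset.card_le_univ A
  have e : {i : Fin n // n ≤ i.val + m} ≃ {i : Fin n // i ∈ A} := by
    refine Fintype.equivOfCardEq ?_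
    rw [Fintype.card_subtype, card_filter_le_val_add hm, Fintype.card_coe, hA]
  refine ⟨e.extendSubtype, fun i => ⟨fun h => ?_, fun h => e.extendSubtype_mem i h⟩⟩
  by_contra hc
  exact e.extendSubtype_not_mem i hc h

theorem exists_perm_of_card_le {m : ℕ} (hm : m ≤ n) {A : Finset (Fin n)} (hA : A.card ≤ m) :
    ∃ σ : Equiv.Perm (Fin n), ∀ i, σ i ∈ A → n ≤ i.val + m := by
  obtain ⟨B, hAB, hB⟩ := Finset.exists_superset_card_eq hA (by simpa using hm)
  obtain ⟨σ, hσ⟩ := exists_perm_mem_iff hB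
  exact ⟨σ, fun i hi => (hσ i).1 (hAB hi)⟩

theorem congruent_graphOver_perm (σ : Equiv.Perm (Fin n)) (f : Fin n → ℝ → ℝ)
    (J : Fin n → Set ℝ) :
    AreCongruent (graphOver (translationFun f) (Set.univ.pi J))
      (graphOver (translationFun fun i => f (σ i)) (Set.univ.pi fun i => J (σ i))) := by
  -- The height coordinate stays fixed. The inverse of σ is used because `piLpCongrLeft` reads the
  -- i-th coordinate at the preimage of i under `e`.
  set e : Fin (n + 1) ≃ Fin (n + 1) :=
    (finSuccEquivLast.trans (Equiv.optionCongr σ.symm)).trans finSuccEquivLast.symm with he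
  set φ := LinearIsometryEquiv.piLpCongrLeft 2 ℝ ℝ e
  have hφ : ∀ x, φ (graphParam (translationFun f) x) =
      graphParam (translationFun fun i => f (σ i)) fun i => x (σ i) := by
    intro x
    ext i
    have hsum : translationFun (fun i => f (σ i)) (fun i => x (σ i)) = translationFun f x :=
      Equiv.sum_comp σ fun i => f i (x i)
    rw [LinearIsometryEquiv.piLpCongrLeft_apply, graphParam, graphParam, hsum]
    refine Fin.lastCases ?_ (fun i => ?_) i <;> simp [he, Equiv.piCongrLeft']
  refine ⟨φ.toIsometryEquiv, ?_⟩
  ext z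
  constructor
  · rintro ⟨_, ⟨x, hx, rfl⟩, rfl⟩
    exact ⟨fun i => x (σ i), fun i _ => hx (σ i) (Set.mem_univ _), (hφ x).symm⟩
  · rintro ⟨x, hx, rfl⟩
    refine ⟨_, ⟨fun i => x (σ.symm i), fun i _ => ?_, rfl⟩, ?_⟩
    · simpa using hx (σ.symm i) (Set.mem_univ _)
    · refine (hφ _).trans ?_
      simp

theorem graphOver_congr {F G : (Fin n → ℝ) → ℝ} {Ω : Set (Fin n → ℝ)}
    (h : ∀ x ∈ Ω, F x = G x) : graphOver F Ω = graphOver G Ω :=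
  Set.image_congr fun x hx => by rw [graphParam, graphParam, h x hx]

end Indices

/-! ### Vertical cylinders -/

section Cylinder

variable {n r : ℕ}

theorem graphCurvature_cylinder_eq_zero (hr : 1 ≤ r) (hrn : r < n) {K : Fin n → Set ℝ}
    (hK : ∀ i, IsOpenInterval (K i)) {g : Fin n → ℝ → ℝ} (hg : ∀ i, ContDiffOn ℝ ∞ (g i) (K i))
    (haff : ∀ i : Fin n, ¬ n < i.val + r → ∀ t, deriv (deriv (g i)) t = 0) {x : Fin n → ℝ}
    (hx : x ∈ Set.univ.pi K) : graphCurvature r (translationFun g) x = 0 := by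
  rw [graphCurvature_translationFun_eq_zero_iff hrn hK hg hx,
    -- Only the last r - 1 variables can be non-affine, too few for a term of degree r.
    mixedSum_of_subset (A := univ.filter fun i : Fin n => n ≤ i.val + (r - 1)) (Finset.subset_univ _)]
  · exact mixedSum_of_card_lt (by rw [card_filter_le_val_add (by omega)]; omega) _ _ _
  · intro i _ hi
    simp only [Finset.mem_filter, Finset.mem_univ, true_and] at hi
    exact haff i (by omega) _

theorem IsCylinderGraph.exists_translationFun (hr : 1 ≤ r) (hrn : r < n)
    {M : Set (EuclideanSpace ℝ (Fin (n + 1)))} (hM : IsCylinderGraph r M) :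
    ∃ (K : Fin n → Set ℝ) (g : Fin n → ℝ → ℝ), (∀ i, IsOpenInterval (K i)) ∧
      (∀ i, ContDiffOn ℝ ∞ (g i) (K i)) ∧ M = graphOver (translationFun g) (Set.univ.pi K) ∧
      ∀ x ∈ Set.univ.pi K, graphCurvature r (translationFun g) x = 0 := by
  obtain ⟨K, a, f, b, hK, hf, rfl⟩ := hM
  have hn : (n : ℝ) ≠ 0 := by
    have : n ≠ 0 := by omega
    exact_mod_cast this
  -- A translation function has no separate constant, so b is spread evenly over the n summands.
  set g : Fin n → ℝ → ℝ := fun i t =>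
    (if n < i.val + r then f i t else a i * t) + b / n with hgdef
  have hg : ∀ i, ContDiffOn ℝ ∞ (g i) (K i) := by
    intro i
    by_cases hi : n < i.val + r
    · simp only [hgdef, if_pos hi]
      exact (hf i hi).add contDiffOn_const
    · simp only [hgdef, if_neg hi]
      fun_prop
  refine ⟨K, g, hK, hg, graphOver_congr fun x _ => ?_, fun x hx => ?_⟩
  · rw [cylinderFun, translationFun, Finset.sum_add_distrib, Finset.sum_const, Finset.card_univ,
      Fintype.card_fin, nsmul_eq_mul, mul_div_cancel₀ _ hn, Finset.sum_ite, add_comm (∑ i with _, _)]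
    congr 3
    exact Finset.filter_congr fun i _ => by omega
  · refine graphCurvature_cylinder_eq_zero hr hrn hK hg (fun i hi t => ?_) hx
    have h1 : deriv (g i) = fun _ => a i := by
      funext s
      simp only [hgdef, if_neg hi]
      simp
    rw [h1, deriv_const]

theorem isCylinderGraph_of_perm {J : Fin n → Set ℝ} (hJ : ∀ i, IsOpenInterval (J i))
    {f : Fin n → ℝ → ℝ} (hf : ∀ i, ContDiffOn ℝ ∞ (f i) (J i)) {a d : Fin n → ℝ}
    (haff : ∀ i : Fin n, ¬ n < i.val + r → ∀ t ∈ J i, f i t = a i * t + d i) :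
    IsCylinderGraph r (graphOver (translationFun f) (Set.univ.pi J)) := by
  refine ⟨J, a, f, ∑ i with ¬ n < i.val + r, d i, hJ, fun j _ => hf j,
    graphOver_congr fun x hx => ?_⟩
  rw [translationFun, cylinderFun, ← Finset.sum_filter_not_add_sum_filter _ (fun i : Fin n => n < i.val + r)]
  have h1 : ∑ i with ¬ n < i.val + r, f i (x i) =
      ∑ i with i.val + r ≤ n, a i * x i + ∑ i with ¬ n < i.val + r, d i := by
    have h2 : (univ.filter fun i : Fin n => i.val + r ≤ n) =
        univ.filter fun i : Fin n => ¬ n < i.val + r :=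
      Finset.filter_congr fun i _ => by omega
    rw [h2, ← Finset.sum_add_distrib]
    refine Finset.sum_congr rfl fun i hi => ?_
    exact haff i (Finset.mem_filter.1 hi).2 _ (hx i (Set.mem_univ i))
  rw [h1]
  ring

end Cylinder

/-! ### Generalized periodic Enneper hypersurfaces -/

section Enneper

variable {n r : ℕ}

theorem mem_affineIdx {i : Fin n} : i ∈ affineIdx n r ↔ i.val + r + 1 < n := by
  simp [affineIdx]

theorem mem_cosIdx {i : Fin n} : i ∈ cosIdx n r ↔ n ≤ i.val + 1 + r ∧ i.val + 1 < n := by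
  simp [cosIdx]

theorem lastIdx_notMem_cosIdx (h : r < n) : lastIdx h ∉ cosIdx n r := by
  rw [mem_cosIdx, lastIdx]
  dsimp only
  omega

theorem insert_lastIdx_cosIdx (h : r < n) :
    insert (lastIdx h) (cosIdx n r) = univ.filter fun i : Fin n => n ≤ i.val + (r + 1) := by
  ext i
  rw [Finset.mem_insert, mem_cosIdx, Finset.mem_filter, Fin.ext_iff, lastIdx]
  have := i.isLt
  simp only [Finset.mem_univ, true_and]
  omega

theorem card_cosIdx (h : r < n) : (cosIdx n r).card = r := by
  have h1 := congrArg Finset.card (insert_lastIdx_cosIdx h)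
  rw [Finset.card_insert_of_notMem (lastIdx_notMem_cosIdx h), card_filter_le_val_add h] at h1
  omega

theorem affineIdx_eq_sdiff (h : r < n) :
    affineIdx n r = univ \ insert (lastIdx h) (cosIdx n r) := by
  rw [insert_lastIdx_cosIdx]
  ext i
  rw [mem_affineIdx]
  simp only [Finset.mem_sdiff, Finset.mem_filter, Finset.mem_univ, true_and]
  omega

theorem sum_univ_eq (h : r < n) (F : Fin n → ℝ) :
    ∑ i, F i = ∑ i ∈ affineIdx n r, F i + ∑ i ∈ cosIdx n r, F i + F (lastIdx h) := by
  rw [affineIdx_eq_sdiff h, ← Finset.sum_sdiff (Finset.subset_univ (insert (lastIdx h) (cosIdx n r))),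
    Finset.sum_insert (lastIdx_notMem_cosIdx h)]
  ring

theorem elemSymm_cosIdx (hr : 1 ≤ r) (h : r < n) {a : Fin n → ℝ} (ha : ∀ k ∈ cosIdx n r, a k ≠ 0) :
    elemSymm (r - 1) (cosIdx n r) a = (∏ k ∈ cosIdx n r, a k) * ∑ k ∈ cosIdx n r, (a k)⁻¹ :=
  elemSymm_card_succ (by rw [card_cosIdx h]; omega) ha

theorem enneperSlope_eq (hr : 1 ≤ r) (h : r < n) {a : Fin n → ℝ}
    (ha : ∀ k ∈ cosIdx n r, a k ≠ 0) :
    enneperSlope r a = -(∑ k ∈ cosIdx n r, (a k)⁻¹)⁻¹ := by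
  have hp : ∏ k ∈ cosIdx n r, a k ≠ 0 := Finset.prod_ne_zero_iff.2 ha
  rw [enneperSlope, elemSymm_cosIdx hr h ha, div_mul_eq_div_div, div_self hp, one_div]

/-- The coefficient of the `i`-th variable in the argument of its cosine. -/
def enneperRate (h : r < n) (a : Fin n → ℝ) (i : Fin n) : ℝ :=
  if i = lastIdx h then enneperSlope r a else a i

/-- The `i`-th summand of `enneperFun`, up to a constant. -/
def enneperSummand (h : r < n) (a b : Fin n → ℝ) (i : Fin n) (t : ℝ) : ℝ :=
  if i ∈ affineIdx n r then a i * t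
  else -(enneperRate h a i)⁻¹ * Real.log (Real.cos (enneperRate h a i * √(enneperBeta r a) * t + b i))

theorem enneperRate_last (h : r < n) (a : Fin n → ℝ) :
    enneperRate h a (lastIdx h) = enneperSlope r a := if_pos rfl

theorem enneperRate_of_mem (h : r < n) (a : Fin n → ℝ) {k : Fin n} (hk : k ∈ cosIdx n r) :
    enneperRate h a k = a k :=
  if_neg (ne_of_mem_of_not_mem hk (lastIdx_notMem_cosIdx h))

/-- The geometric content of the slope formula: the last rate is chosen so that the separation
constants, the reciprocals of the rates, sum to 0. -/
theorem sum_enneperRate_inv (hr : 1 ≤ r) (h : r < n) {a : Fin n → ℝ}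
    (ha : ∀ k ∈ cosIdx n r, a k ≠ 0) :
    ∑ i ∈ insert (lastIdx h) (cosIdx n r), (enneperRate h a i)⁻¹ = 0 := by
  rw [Finset.sum_insert (lastIdx_notMem_cosIdx h), enneperRate_last, enneperSlope_eq hr h ha,
    Finset.sum_congr rfl fun k hk => congrArg Inv.inv (enneperRate_of_mem h a hk), inv_neg, inv_inv,
    neg_add_cancel]

theorem enneperBeta_pos (a : Fin n → ℝ) : 0 < enneperBeta r a := by
  unfold enneperBeta
  positivity

theorem enneperFun_eq_sum (hr : 1 ≤ r) (h : r < n) {a b : Fin n → ℝ} {c : ℝ}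
    (ha : ∀ k ∈ cosIdx n r, a k ≠ 0) {x : Fin n → ℝ}
    (hx : ∀ i ∈ insert (lastIdx h) (cosIdx n r),
      |enneperRate h a i * √(enneperBeta r a) * x i + b i| < Real.pi / 2) :
    enneperFun h a b c x = ∑ i, enneperSummand h a b i (x i) + c := by
  have hnot : ∀ i ∈ insert (lastIdx h) (cosIdx n r), i ∉ affineIdx n r := by
    intro i hi
    rw [affineIdx_eq_sdiff h]
    simp [hi]
  have hlast := hx _ (Finset.mem_insert_self _ _)
  rw [enneperRate_last] at hlast
  set A := Real.log (Real.cos (enneperSlope r a * √(enneperBeta r a) * x (lastIdx h) +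
    b (lastIdx h))) with hA
  have hcos : ∀ k ∈ cosIdx n r, 1 / a k * Real.log
      |Real.cos (enneperSlope r a * √(enneperBeta r a) * x (lastIdx h) + b (lastIdx h)) /
        Real.cos (a k * √(enneperBeta r a) * x k + b k)| =
      (a k)⁻¹ * A + enneperSummand h a b k (x k) := by
    intro k hk
    have hk' := hx k (Finset.mem_insert_of_mem hk)
    rw [enneperSummand, if_neg (hnot k (Finset.mem_insert_of_mem hk))]
    rw [enneperRate_of_mem h a hk] at hk' ⊢
    rw [Real.log_abs, Real.log_div (cos_pos_of_abs_lt hlast).ne' (cos_pos_of_abs_lt hk').ne', ← hA]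
    ring
  rw [enneperFun, Finset.sum_congr rfl hcos, Finset.sum_add_distrib, ← Finset.sum_mul,
    sum_univ_eq h]
  have h1 : ∑ i ∈ affineIdx n r, enneperSummand h a b i (x i) =
      ∑ i ∈ affineIdx n r, a i * x i :=
    Finset.sum_congr rfl fun i hi => if_pos hi
  -- The numerators of the r quotients share one cosine; their coefficients add up to ∑ 1/a_k, which
  -- is minus the reciprocal of the last rate.
  have h2 : enneperSummand h a b (lastIdx h) (x (lastIdx h)) =
      (∑ k ∈ cosIdx n r, (a k)⁻¹) * A := by
    rw [enneperSummand, if_neg (hnot _ (Finset.mem_insert_self _ _)), enneperRate_last, ← hA,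
      enneperSlope_eq hr h ha, inv_neg, inv_inv, neg_neg]
  rw [h1, h2]
  ring

/-- Converse of `exists_separation_constants`: the separated equations turn the mixed sum into (∏
h_i) ∑ c_i. -/
theorem mixedSum_eq_zero_of_separation {A : Finset (Fin n)} (hA : A.card = r + 1) {h w c : Fin n → ℝ}
    (hh : ∀ i, i ∉ A → h i = 0) (hc : ∀ i ∈ A, c i * h i = 1 + ∑ m ∈ univ \ A, w m + w i)
    (hsum : ∑ i ∈ A, c i = 0) : mixedSum r univ 1 h w = 0 := by
  rw [mixedSum_of_subset (Finset.subset_univ A) fun i _ hi => hh i hi, mixedSum_card_succ hA]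
  have h1 : ∀ m ∈ A, (1 + ∑ l ∈ univ \ A, w l + w m) * ∏ i ∈ A.erase m, h i =
      (∏ i ∈ A, h i) * c m := by
    intro m hm
    rw [← Finset.mul_prod_erase A h hm, ← hc m hm]
    ring
  rw [Finset.sum_congr rfl h1, ← Finset.mul_sum, hsum, mul_zero]

theorem IsEnneperGraph.exists_translationFun (hr : 1 ≤ r) (h : r < n)
    {M : Set (EuclideanSpace ℝ (Fin (n + 1)))} (hM : IsEnneperGraph h M) :
    ∃ (K : Fin n → Set ℝ) (g : Fin n → ℝ → ℝ), (∀ i, IsOpenInterval (K i)) ∧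
      (∀ i, ContDiffOn ℝ ∞ (g i) (K i)) ∧ M = graphOver (translationFun g) (Set.univ.pi K) ∧
      ∀ x ∈ Set.univ.pi K, graphCurvature r (translationFun g) x = 0 := by
  obtain ⟨K, a, b, c, hK, ha, hσ, hcos, hlast, rfl⟩ := hM
  have hn : (n : ℝ) ≠ 0 := by
    have : n ≠ 0 := by omega
    exact_mod_cast this
  have hslope : enneperSlope r a ≠ 0 := by
    rw [enneperSlope]
    exact neg_ne_zero.2 (div_ne_zero (Finset.prod_ne_zero_iff.2 ha) hσ)
  set A := insert (lastIdx h) (cosIdx n r) with hAdef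
  have hβ := enneperBeta_pos (r := r) a
  have hrate : ∀ i ∈ A, enneperRate h a i ≠ 0 ∧
      ∀ t ∈ K i, |enneperRate h a i * √(enneperBeta r a) * t + b i| < Real.pi / 2 := by
    intro i hi
    rcases Finset.mem_insert.1 hi with rfl | hi
    · rw [enneperRate_last]
      exact ⟨hslope, hlast⟩
    · rw [enneperRate_of_mem h a hi]
      exact ⟨ha i hi, hcos i hi⟩
  have haff : ∀ i, i ∈ affineIdx n r ↔ i ∉ A := by
    intro i
    rw [affineIdx_eq_sdiff h]
    simp [hAdef]
  set g : Fin n → ℝ → ℝ := fun i t => enneperSummand h a b i t + c / n with hgdef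
  have hgaff : ∀ i ∉ A, g i = fun t => a i * t + c / n := fun i hi => by
    funext t
    rw [hgdef]
    dsimp only
    rw [enneperSummand, if_pos ((haff i).2 hi)]
  have hgcos : ∀ i ∈ A, g i = fun t => -(enneperRate h a i)⁻¹ *
      Real.log (Real.cos (enneperRate h a i * √(enneperBeta r a) * t + b i)) + c / n :=
    fun i hi => by
      funext t
      rw [hgdef]
      dsimp only
      rw [enneperSummand, if_neg fun hi' => (haff i).1 hi' hi]
  have hg : ∀ i, ContDiffOn ℝ ∞ (g i) (K i) := by
    intro i
    by_cases hi : i ∈ A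
    · rw [hgcos i hi]
      exact (contDiffOn_log_cos (hrate i hi).2).add contDiffOn_const
    · rw [hgaff i hi]
      fun_prop
  have hd1 : ∀ i ∉ A, deriv (g i) = fun _ => a i := fun i hi => by
    rw [hgaff i hi]
    funext t
    simp
  have hd2 : ∀ i ∈ A, ∀ t ∈ K i, deriv (g i) t =
      √(enneperBeta r a) * Real.tan (enneperRate h a i * √(enneperBeta r a) * t + b i) :=
    fun i hi t ht => by
      rw [hgcos i hi]
      exact ((hasDerivAt_log_cos (hrate i hi).1 ((hrate i hi).2 t ht)).add_const _).deriv
  refine ⟨K, g, hK, hg, graphOver_congr fun x hx => ?_, fun x hx => ?_⟩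
  · rw [enneperFun_eq_sum hr h ha fun i hi => (hrate i hi).2 _ (hx i (Set.mem_univ i)),
      translationFun, Finset.sum_add_distrib, Finset.sum_const, Finset.card_univ,
      Fintype.card_fin, nsmul_eq_mul, mul_div_cancel₀ _ hn]
  · rw [graphCurvature_translationFun_eq_zero_iff h hK hg hx]
    refine mixedSum_eq_zero_of_separation (A := A) (c := fun i => (enneperRate h a i)⁻¹) ?_ ?_ ?_
      (sum_enneperRate_inv hr h ha)
    · rw [hAdef, insert_lastIdx_cosIdx, card_filter_le_val_add h]
    · intro i hi
      rw [hd1 i hi, deriv_const]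
    · intro i hi
      have hxi := hx i (Set.mem_univ i)
      have h1 : 1 + ∑ m ∈ univ \ A, deriv (g m) (x m) ^ 2 = enneperBeta r a := by
        rw [enneperBeta, affineIdx_eq_sdiff h]
        congr 1
        exact Finset.sum_congr rfl fun m hm => by rw [hd1 m (Finset.mem_sdiff.1 hm).2]
      have h2 : deriv (g i) =ᶠ[nhds (x i)] fun t =>
          √(enneperBeta r a) * Real.tan (enneperRate h a i * √(enneperBeta r a) * t + b i) := by
        filter_upwards [(hK i).1.mem_nhds hxi] with t ht
        exact hd2 i hi t ht
      rw [h1, hd2 i hi _ hxi, h2.deriv_eq,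
        (hasDerivAt_tan_linear hβ ((hrate i hi).2 _ hxi)).deriv,
        inv_mul_cancel_left₀ (hrate i hi).1]

theorem isEnneperGraph_of_perm (hr : 1 ≤ r) (h : r < n) {J : Fin n → Set ℝ}
    (hJ : ∀ i, IsOpenInterval (J i)) {f : Fin n → ℝ → ℝ} {a b d : Fin n → ℝ}
    (hne : ∀ i ∉ affineIdx n r, a i ≠ 0) (hsum : ∑ i ∈ univ \ affineIdx n r, (a i)⁻¹ = 0)
    (haff : ∀ i ∈ affineIdx n r, ∀ t ∈ J i, f i t = a i * t + d i)
    (hcos : ∀ i ∉ affineIdx n r, ∀ t ∈ J i,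
      |a i * √(enneperBeta r a) * t + b i| < Real.pi / 2 ∧
        f i t = -(a i)⁻¹ * Real.log (Real.cos (a i * √(enneperBeta r a) * t + b i)) + d i) :
    IsEnneperGraph h (graphOver (translationFun f) (Set.univ.pi J)) := by
  have hA : univ \ affineIdx n r = insert (lastIdx h) (cosIdx n r) := by
    rw [affineIdx_eq_sdiff h, Finset.sdiff_sdiff_eq_self (Finset.subset_univ _)]
  have hnot : ∀ i ∈ insert (lastIdx h) (cosIdx n r), i ∉ affineIdx n r := by
    intro i hi
    rw [← hA] at hi
    exact (Finset.mem_sdiff.1 hi).2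
  have hl := hnot _ (Finset.mem_insert_self _ _)
  have hk : ∀ k ∈ cosIdx n r, k ∉ affineIdx n r := fun k hk =>
    hnot k (Finset.mem_insert_of_mem hk)
  have hane : ∀ k ∈ cosIdx n r, a k ≠ 0 := fun k hk' => hne k (hk k hk')
  rw [hA, Finset.sum_insert (lastIdx_notMem_cosIdx h)] at hsum
  have hS : ∑ k ∈ cosIdx n r, (a k)⁻¹ = -(a (lastIdx h))⁻¹ := by linarith
  have hslope : enneperSlope r a = a (lastIdx h) := by
    rw [enneperSlope_eq hr h hane, hS, inv_neg, inv_inv, neg_neg]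
  have hrate : ∀ i ∈ insert (lastIdx h) (cosIdx n r), enneperRate h a i = a i := by
    intro i hi
    rcases Finset.mem_insert.1 hi with rfl | hi
    · rw [enneperRate_last, hslope]
    · exact enneperRate_of_mem h a hi
  refine ⟨J, a, b, ∑ i, d i, hJ, hane, ?_, fun k hk' t ht => (hcos k (hk k hk') t ht).1,
    fun t ht => ?_, graphOver_congr fun x hx => ?_⟩
  · rw [elemSymm_cosIdx hr h hane, hS]
    exact mul_ne_zero (Finset.prod_ne_zero_iff.2 hane) (neg_ne_zero.2 (inv_ne_zero (hne _ hl)))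
  · rw [hslope]
    exact (hcos _ hl t ht).1
  · rw [enneperFun_eq_sum hr h hane fun i hi => by
      rw [hrate i hi]
      exact (hcos i (hnot i hi) _ (hx i (Set.mem_univ i))).1, translationFun,
      ← Finset.sum_add_distrib]
    refine Finset.sum_congr rfl fun i _ => ?_
    by_cases hi : i ∈ affineIdx n r
    · rw [enneperSummand, if_pos hi, haff i hi _ (hx i (Set.mem_univ i))]
    · have hi' : i ∈ insert (lastIdx h) (cosIdx n r) := by
        rw [← hA]
        simp [hi]
      rw [enneperSummand, if_neg hi, hrate i hi', (hcos i hi _ (hx i (Set.mem_univ i))).2]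

end Enneper

/-! ### The two directions of the classification -/

section Classification

variable {n r : ℕ}

theorem exists_congruent_of_curvature_eq_zero (hr : 1 ≤ r) (hrn : r < n) {J : Fin n → Set ℝ}
    (hJ : ∀ i, IsOpenInterval (J i)) {f : Fin n → ℝ → ℝ} (hf : ∀ i, ContDiffOn ℝ ∞ (f i) (J i))
    (h : ∀ x ∈ Set.univ.pi J, graphCurvature r (translationFun f) x = 0) :
    ∃ M' : Set (EuclideanSpace ℝ (Fin (n + 1))),
      AreCongruent (graphOver (translationFun f) (Set.univ.pi J)) M' ∧
      (IsCylinderGraph r M' ∨ IsEnneperGraph hrn M') := by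
  classical
  set A : Finset (Fin n) := univ.filter fun i => ∃ t ∈ J i, deriv (deriv (f i)) t ≠ 0 with hAdef
  have hmemA : ∀ i, i ∈ A ↔ ∃ t ∈ J i, deriv (deriv (f i)) t ≠ 0 := fun i => by simp [hAdef]
  have haff : ∀ i, ∃ a d : ℝ, i ∉ A → ∀ t ∈ J i, f i t = a * t + d ∧ deriv (f i) t = a := by
    intro i
    by_cases hi : i ∈ A
    · exact ⟨0, 0, fun h => absurd hi h⟩
    · rw [hmemA] at hi
      push Not at hi
      obtain ⟨a, d, had⟩ := exists_affine_of_deriv_deriv_eq_zero (hJ i) (hf i) hi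
      exact ⟨a, d, fun _ => had⟩
  choose α d had using haff
  set β : ℝ := 1 + ∑ m ∈ univ \ A, α m ^ 2 with hβdef
  have hβ : 0 < β := by positivity
  set V : Fin n → Set (ℝ × ℝ) := fun i =>
    (fun t => (deriv (deriv (f i)) t, deriv (f i) t ^ 2)) '' J i with hV
  have h1 : ∀ i ∈ A, ∃ v ∈ V i, v.1 ≠ 0 := by
    intro i hi
    obtain ⟨t, ht, hne⟩ := (hmemA i).1 hi
    exact ⟨_, ⟨t, ht, rfl⟩, hne⟩
  have h2 : ∀ i ∈ A, ∃ u ∈ V i, ∃ v ∈ V i, u.2 ≠ v.2 := by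
    intro i hi
    obtain ⟨s, hs, t, ht, hne⟩ := exists_sq_deriv_ne (hJ i) (hf i) ((hmemA i).1 hi)
    exact ⟨_, ⟨s, hs, rfl⟩, _, ⟨t, ht, rfl⟩, hne⟩
  have hpos : ∀ i ∈ A, ∀ v ∈ V i, 0 < β + v.2 := by
    rintro i - _ ⟨t, -, rfl⟩
    dsimp only
    positivity
  have hQ : ∀ k w : Fin n → ℝ, (∀ i ∈ A, (k i, w i) ∈ V i) → mixedSum r A β k w = 0 := by
    intro k w hkw
    have hx : ∀ i, ∃ t ∈ J i, i ∈ A → deriv (deriv (f i)) t = k i ∧ deriv (f i) t ^ 2 = w i := by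
      intro i
      by_cases hi : i ∈ A
      · obtain ⟨t, ht, e⟩ := hkw i hi
        exact ⟨t, ht, fun _ => Prod.ext_iff.1 e⟩
      · obtain ⟨t, ht⟩ := (hJ i).2.2
        exact ⟨t, ht, fun h => absurd h hi⟩
    choose x hxJ hx using hx
    have hxpi : x ∈ Set.univ.pi J := fun i _ => hxJ i
    have e := (graphCurvature_translationFun_eq_zero_iff hrn hJ hf hxpi).1 (h x hxpi)
    rw [mixedSum_of_subset (Finset.subset_univ A)] at e
    · rw [mixedSum_congr (fun i hi => (hx i hi).1) (fun i hi => (hx i hi).2),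
        Finset.sum_congr rfl (g := fun m => α m ^ 2)] at e
      · exact e
      · intro m hm
        rw [(had m (Finset.mem_sdiff.1 hm).2 _ (hxJ m)).2]
    · intro i _ hi
      rw [hmemA] at hi
      push Not at hi
      exact hi _ (hxJ i)
  obtain ⟨k, rfl⟩ : ∃ k, r = k + 1 := ⟨r - 1, by omega⟩
  have hcard := card_le_of_mixedSum_eq_zero h1 h2 hpos hQ
  -- With exactly r non-affine variables the mixed sum is β ∏ h_i, and all factors can be made
  -- nonzero at once.
  have hcard' : A.card ≠ k + 1 := by
    intro hc
    obtain ⟨u, w, hu⟩ : ∃ u w : Fin n → ℝ, ∀ i ∈ A, (u i, w i) ∈ V i ∧ u i ≠ 0 := by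
      have : ∀ i, ∃ v : ℝ × ℝ, i ∈ A → v ∈ V i ∧ v.1 ≠ 0 := fun i => by
        by_cases hi : i ∈ A
        · obtain ⟨v, hv⟩ := h1 i hi
          exact ⟨v, fun _ => hv⟩
        · exact ⟨0, fun h => absurd h hi⟩
      choose v hv using this
      exact ⟨fun i => (v i).1, fun i => (v i).2, hv⟩
    have e := hQ u w fun i hi => (hu i hi).1
    rw [← hc, mixedSum_card] at e
    exact mul_ne_zero hβ.ne' (Finset.prod_ne_zero_iff.2 fun i hi => (hu i hi).2) e
  rcases Nat.lt_or_ge A.card (k + 1) with hlt | hge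
  -- At most k = r - 1 non-affine variables, moved into the last r - 1 positions; the remaining ones
  -- of those positions may be affine.
  · obtain ⟨σ, hσ⟩ := exists_perm_of_card_le (m := k) (by omega) (Nat.lt_succ_iff.1 hlt)
    refine ⟨_, congruent_graphOver_perm σ f J, Or.inl ?_⟩
    refine isCylinderGraph_of_perm (fun i => hJ (σ i)) (fun i => hf (σ i))
      (a := fun i => α (σ i)) (d := fun i => d (σ i)) fun i hi t ht => ?_
    exact (had (σ i) (fun hA => hi (by have := hσ i hA; omega)) t ht).1
  · have hc : A.card = k + 2 := by omega
    obtain ⟨c, hc0, hcV, hcsum⟩ := exists_separation_constants hc h1 hpos hQ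
    have hsol : ∀ i, ∃ b e : ℝ, i ∈ A → ∀ t ∈ J i, |(c i)⁻¹ * √β * t + b| < Real.pi / 2 ∧
        f i t = -((c i)⁻¹)⁻¹ * Real.log (Real.cos ((c i)⁻¹ * √β * t + b)) + e := by
      intro i
      by_cases hi : i ∈ A
      · obtain ⟨b, e, hbe⟩ := exists_log_cos_of_deriv_deriv_eq (hJ i) (hf i)
          (inv_ne_zero (hc0 i hi)) hβ fun t ht => by
            rw [← hcV i hi _ ⟨t, ht, rfl⟩, inv_mul_cancel_left₀ (hc0 i hi)]
        exact ⟨b, e, fun _ => hbe⟩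
      · exact ⟨0, 0, fun h => absurd h hi⟩
    choose b e hbe using hsol
    obtain ⟨σ, hσ⟩ := exists_perm_mem_iff hc
    have hσ' : ∀ i, i ∈ affineIdx n (k + 1) ↔ σ i ∉ A := by
      intro i
      rw [mem_affineIdx, hσ]
      omega
    -- One family carries both kinds of parameters: rates 1/c on the non-affine variables, slopes on
    -- the affine ones.
    set a : Fin n → ℝ := fun i => if σ i ∈ A then (c (σ i))⁻¹ else α (σ i) with ha
    have haA : ∀ i, σ i ∈ A → a i = (c (σ i))⁻¹ := fun i hi => if_pos hi
    have hanA : ∀ i, σ i ∉ A → a i = α (σ i) := fun i hi => if_neg hi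
    have hβ' : enneperBeta (k + 1) a = β := by
      rw [enneperBeta, hβdef]
      congr 1
      refine Finset.sum_equiv σ (fun i => ?_) fun i hi => by rw [hanA i ((hσ' i).1 hi)]
      rw [hσ']
      simp
    have hnA : ∀ i, i ∉ affineIdx n (k + 1) → σ i ∈ A := fun i hi => by
      rwa [hσ', not_not] at hi
    refine ⟨_, congruent_graphOver_perm σ f J, Or.inr ?_⟩
    refine isEnneperGraph_of_perm hr hrn (fun i => hJ (σ i)) (a := a) (b := fun i => b (σ i))
      (d := fun i => if σ i ∈ A then e (σ i) else d (σ i)) ?_ ?_ ?_ ?_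
    · intro i hi
      rw [haA i (hnA i hi)]
      exact inv_ne_zero (hc0 _ (hnA i hi))
    · rw [← hcsum]
      refine Finset.sum_equiv σ (fun i => ?_) fun i hi => ?_
      · simp [hσ']
      · rw [haA i (hnA i (Finset.mem_sdiff.1 hi).2), inv_inv]
    · intro i hi t ht
      have hi' := (hσ' i).1 hi
      rw [hanA i hi', if_neg hi']
      exact (had _ hi' t ht).1
    · intro i hi t ht
      rw [haA i (hnA i hi), if_pos (hnA i hi), hβ']
      exact hbe _ (hnA i hi) t ht

theorem curvature_eq_zero_of_congruent (hr : 1 ≤ r) (hrn : r < n) {J : Fin n → Set ℝ}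
    (hJ : ∀ i, IsOpenInterval (J i)) {f : Fin n → ℝ → ℝ} (hf : ∀ i, ContDiffOn ℝ ∞ (f i) (J i))
    {M' : Set (EuclideanSpace ℝ (Fin (n + 1)))}
    (hcong : AreCongruent (graphOver (translationFun f) (Set.univ.pi J)) M')
    (hM' : IsCylinderGraph r M' ∨ IsEnneperGraph hrn M') {x : Fin n → ℝ}
    (hx : x ∈ Set.univ.pi J) : graphCurvature r (translationFun f) x = 0 := by
  obtain ⟨K, g, hK, hg, rfl, hcurv⟩ := hM'.elim (IsCylinderGraph.exists_translationFun hr hrn)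
    (IsEnneperGraph.exists_translationFun hr hrn)
  obtain ⟨φ, hφ⟩ := hcong
  exact graphCurvature_eq_zero_of_isometry (IsOpenInterval.isOpen_pi hJ)
    (IsOpenInterval.isOpen_pi hK) (contDiffOn_translationFun hf) (contDiffOn_translationFun hg)
    φ hφ.subset hcurv hx

end Classification

end TranslationHypersurface

end

theorem theorem1 (n r : ℕ) (hn : 3 ≤ n) (hr : 2 < r) (hrn : r < n)
    (J : Fin n → Set ℝ) (hJ : ∀ i, TranslationHypersurface.IsOpenInterval (J i))
    (f : Fin n → ℝ → ℝ) (hf : ∀ i, ContDiffOn ℝ ∞ (f i) (J i)) :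
    (∀ x ∈ Set.univ.pi J,
      TranslationHypersurface.graphCurvature r (TranslationHypersurface.translationFun f) x = 0) ↔
    ∃ M' : Set (EuclideanSpace ℝ (Fin (n + 1))),
      TranslationHypersurface.AreCongruent
        (TranslationHypersurface.graphOver (TranslationHypersurface.translationFun f)
          (Set.univ.pi J)) M' ∧
      (TranslationHypersurface.IsCylinderGraph r M' ∨
        TranslationHypersurface.IsEnneperGraph hrn M') :=
  ⟨TranslationHypersurface.exists_congruent_of_curvature_eq_zero (by omega) hrn hJ hf,
    fun ⟨_, hcong, hM'⟩ _ hx =>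
      TranslationHypersurface.curvature_eq_zero_of_congruent (by omega) hrn hJ hf hcong hM' hx⟩
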